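/- All logarithms are in base $2$. Let $n\ge 32$ and put $L=\lceil\log n\rceil$, $ll=\lceil\log\log n\rceil$, $k=24L+1$. **Model.** A radio network is a connected undirected graph $G$ with $n$ nodes (stations) and diameter $D$. Time is divided into synchronous rounds $0,1,2,\dots$, round $t$ lasting from time $t$ to time $t+1$; all stations know $n$ and the number of the current round, and have independent sources of random bits. In each round a station either transmits or listens; it receives the message in a round if and only if it listens and exactly one of its neighbours transmits. At time $0$ only one station, the originator, has the message; stations without the message only listen. **Subprocedures** (each call occupies $k$ consecutive rounds $0,1,\dots,k-1$). *Balls-into-Bins*$(k)$: choose $i\in\{0,\dots,k-1\}$ uniformly at random and transmit in round $i$ of the call. *Green-Decay*$(k)$: transmit in round $0$; then in each of the rounds $1,2,\dots,k-1$ toss a fair coin, and at the first toss that gives $1$ transmit in that round and stop. **Algorithm Green-Decay Broadcast.** Time is divided into phases of $3k$ rounds, numbered $0,1,2,\dots$ from time $0$; each phase is divided into three blocks of $k$ rounds. A station that receives the message waits for the next beginning of a phase (a phase that begins at the very time when it gets the message is allowed; the originator starts at time $0$), with $state=\mathtt{new}$, and then performs the following iteration in each of $2L+2$ consecutive phases,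 after which it terminates. In the phase with number $q$, let $phase=q \bmod ll$. 1. If $phase=0$, set $state=\mathtt{normal}$. 2. If $state=\mathtt{new}$, run Balls-into-Bins$(k)$ in the first block. Otherwise, if $phase=0$, run Balls-into-Bins$(k)$ in the second block. 3. If $phase=0$ or $state=\mathtt{new}$, set $state=\mathtt{normal}$ and choose $myPhase\in\{0,\dots,ll-1\}$ uniformly at random. 4. If $phase=myPhase$, run Green-Decay$(k)$ in the third block. **Theorem.** There is an absolute constant $C>0$ such that for every $n\ge 32$, every connected graph $G$ with $n$ nodes and diameter $D$, and every originator: 1. with probability at least $1-\frac2n$, by time $C\,(D+\log n)\log n$ every station has received the message and has terminated the algorithm; 2. in every execution (for all outcomes of the random choices), every station transmits in at most $C\,\frac{\log n}{\log\log n}$ rounds. -/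

import Mathlib

namespace GDB

/-! ### Parameters of the algorithm for a network of `n` stations (logarithms in base 2) -/

/-- `⌈log n⌉`. -/
noncomputable def logCeil (n : ℕ) : ℕ := ⌈Real.logb 2 n⌉₊

/-- `ll = ⌈log log n⌉`, the number of phases of an epoch. -/
noncomputable def ll (n : ℕ) : ℕ := ⌈Real.logb 2 (Real.logb 2 n)⌉₊

/-- `k = 24 ⌈log n⌉ + 1`, the number of rounds taken by one call of a subprocedure. -/
noncomputable def k (n : ℕ) : ℕ := 24 * logCeil n + 1

/-- A phase is made of three blocks of `k` rounds; it is one iteration of the main loop. -/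
noncomputable def phaseLength (n : ℕ) : ℕ := 3 * k n

/-- The number of iterations of the main loop. -/
noncomputable def iterations (n : ℕ) : ℕ := 2 * logCeil n + 2

/-! ### Random choices -/

/-- The random choices available to one station in one phase: a slot for `Balls-into-Bins(k)`,
a value of `Random([0, …, ll - 1])`, and the coin tosses of `Green-Decay(k)`. -/
abbrev Draw (n : ℕ) : Type := Fin (k n) × Fin (ll n) × (Fin (k n - 1) → Bool)

theorem ll_pos {n : ℕ} (hn : 32 ≤ n) : 0 < ll n := by
  have h5 : (5 : ℝ) ≤ Real.logb 2 n := by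
    rw [Real.le_logb_iff_rpow_le (by norm_num) (by positivity)]
    norm_num
    exact hn
  exact Nat.ceil_pos.mpr (Real.logb_pos (by norm_num) (by linarith))

theorem nonempty_draw {n : ℕ} (hn : 32 ≤ n) : Nonempty (Draw n) :=
  ⟨⟨⟨0, Nat.succ_pos _⟩, ⟨0, ll_pos hn⟩, fun _ => false⟩⟩

/-- The law of all random choices: independent over phases and stations, each uniform. The value
at `q v` holds the choices of station `v` in the `q`-th phase counted from time `0`. -/
noncomputable def randomness (V : Type*) [Fintype V] (n : ℕ) (hn : 32 ≤ n) :
    MeasureTheory.Measure (ℕ → V → Draw n) :=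
  haveI : Nonempty (Draw n) := nonempty_draw hn
  MeasureTheory.Measure.infinitePi fun _ : ℕ =>
    MeasureTheory.Measure.pi fun _ : V =>
      (ProbabilityTheory.uniformOn Set.univ : MeasureTheory.Measure (Draw n))

/-! ### The program of a single station -/

/-- `Green-Decay(k)`: transmit in round `0` of the block; then, in rounds `1, 2, …, k - 1` of the
block, toss a fair coin, and stop with a transmission at the first toss that gives `1`.
`GreenDecay c r` says that a transmission takes place in round `r`, where `c j` is the toss made
in round `j + 1`. -/
def GreenDecay {m : ℕ} (c : Fin m → Bool) (r : ℕ) : Prop :=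
  r = 0 ∨ ∃ j : Fin m, r = j + 1 ∧ c j = true ∧ ∀ i < j, c i = false

/-- The variables of a station at the beginning of an iteration of the main loop. -/
structure Memory where
  /-- whether `state = new` (otherwise `state = normal`) -/
  isNew : Bool
  /-- the variable `myPhase`, `none` before its first assignment -/
  myPhase : Option ℕ

/-- The value of the variable `phase` in the `q`-th phase counted from time `0`. -/
noncomputable def phase (n q : ℕ) : ℕ := q % ll n

/-- The test `state = new`, after a station in state `new` has become `normal` if `phase = 0`. -/
def StillNew (n q : ℕ) (m : Memory) : Prop := m.isNew = true ∧ phase n q ≠ 0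

open Classical in
/-- The variables after the iteration made in phase `q` with random choices `d`: the state is
`normal`, and `myPhase` is drawn afresh if `phase = 0` or the station was still `new`. -/
noncomputable def Memory.next {n : ℕ} (q : ℕ) (m : Memory) (d : Draw n) : Memory where
  isNew := false
  myPhase := if phase n q = 0 ∨ StillNew n q m then some d.2.1 else m.myPhase

/-- In the iteration made in phase `q`, started with variables `m`, the station transmits in round
`r` of the phase. First block: `Balls-into-Bins(k)` of the stations in state `new`. Second block:
`Balls-into-Bins(k)` of all other stations, if `phase = 0`. Third block: `Green-Decay(k)` of the
stations with `phase = myPhase` (for the current value of `myPhase`). -/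
def TransmitsInPhase {n : ℕ} (q : ℕ) (m : Memory) (d : Draw n) (r : ℕ) : Prop :=
  (StillNew n q m ∧ r = d.1) ∨
  (¬ StillNew n q m ∧ phase n q = 0 ∧ r = k n + d.1) ∨
  ((m.next q d).myPhase = some (phase n q) ∧ 2 * k n ≤ r ∧ GreenDecay d.2.2 (r - 2 * k n))

/-- The index of the first phase that begins at time `τ` or later. -/
noncomputable def firstPhase (n τ : ℕ) : ℕ := (τ + (phaseLength n - 1)) / phaseLength n

/-- The variables of a station with random choices `x` before its `i`-th iteration (counted from
`0`), when iteration `0` is made in phase `p`. -/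
noncomputable def memory {n : ℕ} (x : ℕ → Draw n) (p : ℕ) : ℕ → Memory
  | 0 => ⟨true, none⟩
  | i + 1 => (memory x p i).next (p + i) (x (p + i))

/-- A station that has received the message by time `τ`, with random choices `x`, transmits in the
round number `t`. -/
def StationTransmits {n : ℕ} (x : ℕ → Draw n) (τ t : ℕ) : Prop :=
  firstPhase n τ ≤ t / phaseLength n ∧
  t / phaseLength n < firstPhase n τ + iterations n ∧
  TransmitsInPhase (t / phaseLength n)
    (memory x (firstPhase n τ) (t / phaseLength n - firstPhase n τ))
    (x (t / phaseLength n)) (t % phaseLength n)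

/-- The time when a station that received the message at time `τ` ends its program. -/
noncomputable def endTime (n τ : ℕ) : ℕ := phaseLength n * (firstPhase n τ + iterations n)

/-! ### The radio network

Round `t` lasts from time `t` to time `t + 1`. -/

open Classical in
/-- `receptionTime G s ω t v` is `some τ` if station `v` received the message at time `τ ≤ t`, and
`none` if it does not have it at time `t`. The originator `s` has it from time `0` on. A station
without the message listens in each round, and receives in round `t` iff exactly one neighbour
transmits in that round. -/
noncomputable def receptionTime {V : Type*} {n : ℕ} (G : SimpleGraph V) (s : V)
    (ω : ℕ → V → Draw n) : ℕ → V → Option ℕ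
  | 0, v => if v = s then some 0 else none
  | t + 1, v =>
    match receptionTime G s ω t v with
    | some τ => some τ
    | none =>
      if ∃! u, G.Adj v u ∧
          ∃ τ, receptionTime G s ω t u = some τ ∧ StationTransmits (fun q => ω q u) τ t
      then some (t + 1) else none

/-- Station `v` transmits in round `t` of the execution. -/
def Transmits {V : Type*} {n : ℕ} (G : SimpleGraph V) (s : V) (ω : ℕ → V → Draw n)
    (v : V) (t : ℕ) : Prop :=
  ∃ τ, receptionTime G s ω t v = some τ ∧ StationTransmits (fun q => ω q v) τ t

/-- The energy `e_v` of station `v`: the number of rounds in which it transmits. -/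
noncomputable def energy {V : Type*} {n : ℕ} (G : SimpleGraph V) (s : V)
    (ω : ℕ → V → Draw n) (v : V) : ℕ∞ :=
  Set.encard {t | Transmits G s ω v t}

/-- By time `T`, every station has received the message and has ended its program. -/
def CompletesBy {V : Type*} {n : ℕ} (G : SimpleGraph V) (s : V) (ω : ℕ → V → Draw n)
    (T : ℕ) : Prop :=
  ∀ v, ∃ τ, receptionTime G s ω T v = some τ ∧ endTime n τ ≤ T

end GDB

/-! Fix an uninformed station `w` with at least one informed neighbour, all of them still active. If
some phase has a round in which exactly one of them transmits, `w` is informed. The state of its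
neighbourhood gets a `weight`: 1 if it is `Ready`, and otherwise 2 to the number of phases left in
the epoch. The core is `expect_weight_le`: one phase at least halves the expected weight, counted as
0 once `w` is informed. If the neighbourhood is not ready, the weight halves by itself, since every
epoch begins ready. If it is ready and nobody draws `myPhase`, then some neighbour runs Green-Decay,
which fails with probability at most 2/5, and readiness persists. If `m` neighbours draw `myPhase`,
there are two cases. When `m ≤ 2 ll²`, Balls-into-Bins isolates a station except with probability
`2^(-ll)`, which pays for the worst next weight `2^(ll-1)`. When `m ≥ 2 ll²`, all values of
`myPhase` are very likely drawn, so Green-Decay runs now and readiness is kept; the exceptional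
event costs at most 1/10. Two supermartingales follow. First, `2^age * weight` shows that a
neighbour of `w` finishes all `2L+2` iterations before `w` is informed with probability at most
`2^(-(2L+2))`. Secondly, on a shortest path from the originator, `4^(distance left) * (4/3)^q *
weight` works as long as nobody is stalled: when the front advances, a factor 4 is gained and the
weight resets to 1, because the new front station is in state new. After `6(D+L)` phases a given
station is late with probability at most `1/n²`. A union bound over stations gives `2/n`. The energy
bound is deterministic: per epoch a station has at most one transmission of each of four kinds, and
its program meets `O(log n / log log n)` epochs. -/

namespace GDB

open Finset MeasureTheory
open scoped BigOperators ENNReal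

/-! ### Finite uniform probability and resampling of one coordinate -/

section Probability

open Classical in
/-- The probability of `p` under the uniform distribution on `α`. -/
noncomputable def pr {α : Type*} [Fintype α] (p : α → Prop) : ℝ :=
  𝔼 a, if p a then (1 : ℝ) else 0

theorem expect_ite_eq_pr {α : Type*} [Fintype α] (p : α → Prop) [DecidablePred p] :
    𝔼 a, (if p a then (1 : ℝ) else 0) = pr p :=
  expect_congr rfl fun _ _ => by split_ifs <;> rfl

theorem pr_nonneg {α : Type*} [Fintype α] (p : α → Prop) : 0 ≤ pr p :=
  expect_nonneg fun a _ => by split_ifs <;> norm_num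

theorem pr_mono {α : Type*} [Fintype α] {p p' : α → Prop} (h : ∀ a, p a → p' a) :
    pr p ≤ pr p' := by
  refine expect_le_expect fun a _ => ?_
  by_cases hp : p a
  · simp [hp, h a hp]
  · rw [if_neg hp]; split_ifs <;> norm_num

theorem pr_congr {α : Type*} [Fintype α] {p p' : α → Prop} (h : ∀ a, p a ↔ p' a) :
    pr p = pr p' := by
  rw [show p = p' from funext fun a => propext (h a)]

theorem pr_le_one {α : Type*} [Fintype α] [Nonempty α] (p : α → Prop) : pr p ≤ 1 := by
  calc pr p ≤ 𝔼 _a : α, (1 : ℝ) := expect_le_expect fun a _ => by split_ifs <;> norm_num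
    _ = 1 := Fintype.expect_const 1

theorem pr_or_le {α : Type*} [Fintype α] (p p' : α → Prop) :
    pr (fun a => p a ∨ p' a) ≤ pr p + pr p' := by
  unfold pr
  rw [← expect_add_distrib]
  refine expect_le_expect fun a _ => ?_
  by_cases h : p a <;> by_cases h' : p' a <;> simp [h, h']

theorem pr_exists_le {α ι : Type*} [Fintype α] (s : Finset ι) (p : ι → α → Prop) :
    pr (fun a => ∃ i ∈ s, p i a) ≤ ∑ i ∈ s, pr (p i) := by
  classical
  induction s using Finset.induction_on with
  | empty => simp [pr]
  | insert i s hi ih =>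
    rw [sum_insert hi]
    refine le_trans (le_of_eq (pr_congr fun a => ?_)) ((pr_or_le (p i) _).trans
      (add_le_add_right ih _))
    simp

theorem pr_equiv {α β : Type*} [Fintype α] [Fintype β] (e : α ≃ β) (p : β → Prop) :
    pr (fun a => p (e a)) = pr p :=
  Fintype.expect_equiv e _ _ fun _ => rfl

theorem pr_prod {α β : Type*} [Fintype α] [Fintype β] (p : α × β → Prop) :
    pr p = 𝔼 a : α, pr fun b => p (a, b) := by
  unfold pr
  rw [← Finset.univ_product_univ, Finset.expect_product]

theorem pr_prod_le {α β : Type*} [Fintype α] [Fintype β] [Nonempty α] (p : α × β → Prop) {c : ℝ}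
    (h : ∀ a, pr (fun b => p (a, b)) ≤ c) : pr p ≤ c := by
  rw [pr_prod]
  exact (expect_le_expect fun a _ => h a).trans_eq (Fintype.expect_const c)

/-- Exchanging coordinate `i` of `b` with an independent `x` is an involution of the pairs `(b, x)`,
so it preserves the uniform average. -/
theorem expect_update {ι X : Type*} [Fintype ι] [DecidableEq ι] [Fintype X] [Nonempty X]
    (f : (ι → X) → ℝ) (i : ι) :
    𝔼 b, f b = 𝔼 b : ι → X, 𝔼 x, f (Function.update b i x) := by
  rw [← Finset.expect_product', Finset.univ_product_univ]
  let e : ((ι → X) × X) ≃ ((ι → X) × X) :=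
    { toFun := fun y => (Function.update y.1 i y.2, y.1 i)
      invFun := fun y => (Function.update y.1 i y.2, y.1 i)
      left_inv := fun y => by simp
      right_inv := fun y => by simp }
  rw [Fintype.expect_equiv e (fun y => f (Function.update y.1 i y.2)) (fun y => f y.1)
    fun _ => rfl, ← Finset.univ_product_univ, Finset.expect_product]
  simp

/-- Resampling one coordinate. -/
theorem pr_le_mul_of_update {ι X : Type*} [Fintype ι] [DecidableEq ι] [Fintype X] [Nonempty X]
    (p p' : (ι → X) → Prop) (i : ι) {c : ℝ}
    (h : ∀ b, p' b → pr (fun x => p (Function.update b i x)) ≤ c)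
    (h' : ∀ b x, p (Function.update b i x) → p' b) : pr p ≤ c * pr p' := by
  have := expect_update (fun b => open Classical in if p b then (1 : ℝ) else 0) i
  unfold pr at h ⊢
  rw [this, mul_expect]
  refine expect_le_expect fun b _ => ?_
  by_cases hb : p' b
  · simpa [hb] using h b hb
  · have : ∀ x, ¬ p (Function.update b i x) := fun x hx => hb (h' b x hx)
    simp [hb, this]

end Probability

/-! ### A maximal inequality for adapted processes on an infinite product -/

section RandomSequence

variable {E : Type*}

/-- `f` depends on the first `q` coordinates only. -/
def Adapted {β : Type*} (q : ℕ) (f : (ℕ → E) → β) : Prop :=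
  ∀ x y : ℕ → E, (∀ i < q, x i = y i) → f x = f y

theorem Adapted.mono {β : Type*} {q r : ℕ} {f : (ℕ → E) → β} (h : Adapted q f) (hqr : q ≤ r) :
    Adapted r f := fun x y hxy => h x y fun i hi => hxy i (hi.trans_le hqr)

theorem Adapted.measurable {β : Type*} [MeasurableSpace β] [Finite E] [Nonempty E]
    [MeasurableSpace E] [MeasurableSingletonClass E] {q : ℕ} {f : (ℕ → E) → β}
    (h : Adapted q f) : Measurable f := by
  let ext (y : Fin q → E) : ℕ → E := fun i =>
    if hi : i < q then y ⟨i, hi⟩ else Classical.arbitrary E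
  have : f = (fun y => f (ext y)) ∘ fun (x : ℕ → E) (i : Fin q) => x i := by
    funext x
    exact h _ _ fun i hi => by simp [ext, hi]
  rw [this]
  exact (measurable_of_countable _).comp (measurable_pi_lambda _ fun i => measurable_pi_apply _)

theorem measurable_update_prod [MeasurableSpace E] (q : ℕ) :
    Measurable fun y : (ℕ → E) × E => Function.update y.1 q y.2 := by
  refine measurable_pi_lambda _ fun i => ?_
  by_cases hi : i = q
  · subst hi; simpa using measurable_snd
  · simpa [hi] using measurable_fst.eval

/-- Checked on finite boxes, which determine the product measure. It lets one step of a process be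
averaged over the choices of a single phase, with the other phases fixed. -/
theorem map_update_infinitePi [MeasurableSpace E] (ν : Measure E) [IsProbabilityMeasure ν]
    (q : ℕ) :
    ((Measure.infinitePi fun _ : ℕ => ν).prod ν).map
      (fun y : (ℕ → E) × E => Function.update y.1 q y.2) = Measure.infinitePi fun _ : ℕ => ν := by
  have hm := measurable_update_prod (E := E) q
  refine Measure.eq_infinitePi _ fun s t ht => ?_
  rw [Measure.map_apply hm (MeasurableSet.pi s.countable_toSet fun i _ => ht i)]
  by_cases hq : q ∈ s
  · have : (fun y : (ℕ → E) × E => Function.update y.1 q y.2) ⁻¹' (Set.pi s t) =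
        (Set.pi (s.erase q) t) ×ˢ (t q) := by
      ext y
      simp only [Set.mem_preimage, Set.mem_pi, Set.mem_prod, mem_coe, mem_erase]
      constructor
      · intro h
        exact ⟨fun i hi => by simpa [hi.1] using h i hi.2, by simpa using h q hq⟩
      · rintro ⟨h, h'⟩ i hi
        by_cases hiq : i = q
        · subst hiq; simpa using h'
        · simpa [hiq] using h i ⟨hiq, hi⟩
    rw [this, Measure.prod_prod, Measure.infinitePi_pi _ fun i _ => ht i, prod_erase_mul _ _ hq]
  · have : (fun y : (ℕ → E) × E => Function.update y.1 q y.2) ⁻¹' (Set.pi s t) =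
        (Set.pi s t) ×ˢ Set.univ := by
      ext y
      simp only [Set.mem_preimage, Set.mem_pi, Set.mem_prod, mem_coe, Set.mem_univ, and_true]
      refine forall₂_congr fun i hi => ?_
      rw [Function.update_of_ne (fun h : i = q => hq (h ▸ mem_coe.1 hi))]
    rw [this, Measure.prod_prod, Measure.infinitePi_pi _ fun i _ => ht i, measure_univ, mul_one]

theorem lintegral_infinitePi_update [MeasurableSpace E] (ν : Measure E) [IsProbabilityMeasure ν]
    (q : ℕ) {f : (ℕ → E) → ℝ≥0∞} (hf : Measurable f) :
    ∫⁻ x, f x ∂(Measure.infinitePi fun _ : ℕ => ν) =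
      ∫⁻ x, ∫⁻ e, f (Function.update x q e) ∂ν ∂(Measure.infinitePi fun _ : ℕ => ν) := by
  have hm := measurable_update_prod (E := E) q
  conv_lhs => rw [← map_update_infinitePi ν q]
  rw [lintegral_map hf hm]
  exact lintegral_prod _ (hf.comp hm).aemeasurable

theorem lintegral_eq_expect [Fintype E] [Nonempty E] [MeasurableSpace E]
    [MeasurableSingletonClass E]
    {ν : Measure E} (hν : ∀ e, ν {e} = (Fintype.card E : ℝ≥0∞)⁻¹) {f : E → ℝ} (hf : ∀ e, 0 ≤ f e) :
    ∫⁻ e, ENNReal.ofReal (f e) ∂ν = ENNReal.ofReal (𝔼 e, f e) := by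
  rw [lintegral_fintype, Fintype.expect_eq_sum_div_card, ENNReal.ofReal_div_of_pos
    (by exact_mod_cast Fintype.card_pos), ENNReal.ofReal_sum_of_nonneg fun e _ => hf e,
    ENNReal.ofReal_natCast, div_eq_mul_inv, Finset.sum_mul]
  simp [hν]

variable [Fintype E] [Nonempty E] [MeasurableSpace E] [MeasurableSingletonClass E]

/-- A nonnegative process adapted to the independent uniform choices that is a supermartingale as
long as it is not stopped reaches `c` before it is stopped with probability at most `Φ 0 / c`. -/
theorem measure_hit_le {ν : Measure E} [IsProbabilityMeasure ν]
    (hν : ∀ e, ν {e} = (Fintype.card E : ℝ≥0∞)⁻¹)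
    (Φ : ℕ → (ℕ → E) → ℝ) (Stop : ℕ → (ℕ → E) → Prop)
    (hΦ : ∀ q, Adapted q (Φ q)) (hS : ∀ q, Adapted q (Stop q)) (h0 : ∀ q x, 0 ≤ Φ q x)
    (step : ∀ q x, ¬ Stop q x → 𝔼 e, Φ (q + 1) (Function.update x q e) ≤ Φ q x)
    {a c : ℝ} (ha : ∀ x, Φ 0 x ≤ a) (hc : 0 < c) (N : ℕ) :
    (Measure.infinitePi fun _ : ℕ => ν) {x | ∃ q ≤ N, c ≤ Φ q x ∧ ∀ r < q, ¬ Stop r x} ≤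
      ENNReal.ofReal (a / c) := by
  classical
  -- The process is frozen at `c` once it has hit and killed to 0 once it is stopped without a hit.
  -- The modified `Ψ` is a supermartingale everywhere, and Markov's inequality for it at time `N`
  -- gives the claim.
  let Hit (q : ℕ) (x : ℕ → E) : Prop := ∃ r ≤ q, c ≤ Φ r x ∧ ∀ i < r, ¬ Stop i x
  let Ψ (q : ℕ) (x : ℕ → E) : ℝ :=
    if Hit q x then c else if ∃ r < q, Stop r x then 0 else Φ q x
  have hHit : ∀ q, Adapted q (Hit q) := fun q x y hxy => by
    refine propext (exists_congr fun r => and_congr_right fun hr => ?_)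
    rw [(hΦ r).mono hr x y hxy]
    refine and_congr_right fun _ => forall₂_congr fun i hi => ?_
    rw [(hS i).mono (hi.le.trans hr) x y hxy]
  have hSt : ∀ q, Adapted q fun x => ∃ r < q, Stop r x := fun q x y hxy => by
    refine propext (exists_congr fun r => and_congr_right fun hr => ?_)
    rw [(hS r).mono hr.le x y hxy]
  have hΨ : ∀ q, Adapted q (Ψ q) := fun q x y hxy => by
    simp only [Ψ, hHit q x y hxy, hSt q x y hxy, hΦ q x y hxy]
  have hΨ0 : ∀ q x, 0 ≤ Ψ q x := fun q x => by
    simp only [Ψ]; split_ifs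
    exacts [hc.le, le_rfl, h0 q x]
  have hstep : ∀ q x, 𝔼 e, Ψ (q + 1) (Function.update x q e) ≤ Ψ q x := fun q x => by
    have hag : ∀ e, ∀ i < q, Function.update x q e i = x i := fun e i hi =>
      Function.update_of_ne hi.ne _ _
    by_cases h1 : Hit q x
    · have : ∀ e, Ψ (q + 1) (Function.update x q e) = c := fun e => by
        have h2 : Hit q (Function.update x q e) := by rwa [hHit q _ _ (hag e)]
        obtain ⟨r, hr, h3⟩ := h2
        simp only [Ψ]; rw [if_pos ⟨r, hr.trans q.le_succ, h3⟩]
      simp only [this]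
      rw [Fintype.expect_const]
      simp only [Ψ, if_pos h1, le_refl]
    · by_cases h2 : ∃ r < q + 1, Stop r x
      · have : ∀ e, Ψ (q + 1) (Function.update x q e) = 0 := fun e => by
          obtain ⟨r, hr, h3⟩ := h2
          have h4 : Stop r (Function.update x q e) := by
            rwa [(hS r).mono (Nat.lt_succ_iff.1 hr) _ _ (hag e)]
          have h5 : ¬ Hit (q + 1) (Function.update x q e) := by
            rintro ⟨r', hr', h6, h7⟩
            have hrr : r' ≤ r := not_lt.1 fun h => h7 r h h4
            refine h1 ?_
            rw [← hHit q _ _ (hag e)]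
            exact ⟨r', by omega, h6, h7⟩
          simp only [Ψ]; rw [if_neg h5, if_pos ⟨r, hr, h4⟩]
        simp only [this, expect_const_zero]
        exact hΨ0 q x
      · have h3 : ¬ Stop q x := fun h => h2 ⟨q, q.lt_succ_self, h⟩
        have h4 : ¬ ∃ r < q, Stop r x := fun ⟨r, hr, h⟩ => h2 ⟨r, hr.trans q.lt_succ_self, h⟩
        have h5 : Ψ q x = Φ q x := by simp only [Ψ]; rw [if_neg h1, if_neg h4]
        rw [h5]
        refine le_trans (expect_le_expect fun e _ => ?_) (step q x h3)
        simp only [Ψ]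
        split_ifs with h6 h7
        · obtain ⟨r, hr, h7, h8⟩ := h6
          rcases Nat.lt_or_ge r (q + 1) with hr' | hr'
          · refine absurd ?_ h1
            rw [← hHit q _ _ (hag e)]
            exact ⟨r, Nat.lt_succ_iff.1 hr', h7, h8⟩
          · obtain rfl : r = q + 1 := le_antisymm hr hr'
            exact h7
        · exact h0 _ _
        · exact le_rfl
  set μ := Measure.infinitePi fun _ : ℕ => ν
  have hmeas : ∀ q, Measurable fun x => ENNReal.ofReal (Ψ q x) := fun q =>
    ENNReal.measurable_ofReal.comp (hΨ q).measurable
  have hint : ∀ q, ∫⁻ x, ENNReal.ofReal (Ψ q x) ∂μ ≤ ENNReal.ofReal a := fun q => by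
    induction q with
    | zero =>
      calc ∫⁻ x, ENNReal.ofReal (Ψ 0 x) ∂μ ≤ ∫⁻ _x, ENNReal.ofReal a ∂μ := by
            refine lintegral_mono fun x => ENNReal.ofReal_le_ofReal ?_
            simp only [Ψ]
            split_ifs with h1 h2
            · obtain ⟨r, hr, h, -⟩ := h1
              obtain rfl : r = 0 := by omega
              exact h.trans (ha x)
            · exact (h0 0 x).trans (ha x)
            · exact ha x
        _ = ENNReal.ofReal a := by simp [μ]
    | succ q ih =>
      refine le_trans ?_ ih
      rw [lintegral_infinitePi_update ν q (hmeas _)]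
      refine lintegral_mono fun x => ?_
      simp only
      rw [lintegral_eq_expect hν fun e => hΨ0 _ _]
      exact ENNReal.ofReal_le_ofReal (hstep q x)
  have hsub : {x | ∃ q ≤ N, c ≤ Φ q x ∧ ∀ r < q, ¬ Stop r x} ⊆
      {x | ENNReal.ofReal c ≤ ENNReal.ofReal (Ψ N x)} := fun x hx => by
    have : Hit N x := hx
    simp only [Set.mem_ofPred_eq, Ψ]; rw [if_pos this]
  calc μ {x | ∃ q ≤ N, c ≤ Φ q x ∧ ∀ r < q, ¬ Stop r x}
      ≤ μ {x | ENNReal.ofReal c ≤ ENNReal.ofReal (Ψ N x)} := measure_mono hsub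
    _ ≤ (∫⁻ x, ENNReal.ofReal (Ψ N x) ∂μ) / ENNReal.ofReal c :=
        meas_ge_le_lintegral_div (hmeas N).aemeasurable (by simpa using hc) ENNReal.ofReal_ne_top
    _ ≤ ENNReal.ofReal a / ENNReal.ofReal c := by gcongr; exact hint N
    _ = ENNReal.ofReal (a / c) := (ENNReal.ofReal_div_of_pos hc).symm

end RandomSequence

/-! ### Balls into bins: isolated balls and coverage -/

section BallsIntoBins

variable {V X : Type*} [Fintype V] [DecidableEq V] [Fintype X] [Nonempty X]

theorem pr_eq_apply_le {k : ℕ} {f : X → Fin k} (hf : ∀ i, pr (fun x => f x = i) = 1 / k)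
    {u v : V} (huv : u ≠ v) : pr (fun b : V → X => f (b u) = f (b v)) ≤ 1 / k := by
  calc _ ≤ 1 / (k : ℝ) * pr (fun _ : V → X => True) := by
        refine pr_le_mul_of_update _ _ u (fun b _ => ?_) fun _ _ _ => trivial
        simp only [Function.update_self, Function.update_of_ne huv.symm]
        exact (hf _).le
    _ ≤ 1 / k * 1 := by gcongr; exact pr_le_one _
    _ = 1 / k := mul_one _

/-- Take two balls `u ≠ w`. If neither is alone, they share a bin (probability at most `1/k`), or
they lie in different bins and are joined there by balls `i` and `j` other than `u` and `w`. For
fixed `(i, j)`, resampling `u` and then `w` bounds this by `1/k²`, and there are at most `#A²`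
pairs. A single ball cannot fail. -/
theorem pr_no_singleton_le {k : ℕ} {f : X → Fin k} (hf : ∀ i, pr (fun x => f x = i) = 1 / k)
    {A : Finset V} (hA : A.Nonempty) :
    pr (fun b : V → X => ∀ u ∈ A, ∃ v ∈ A, v ≠ u ∧ f (b v) = f (b u)) ≤
      1 / k + (#A / k : ℝ) ^ 2 := by
  obtain ⟨u, hu⟩ := hA
  by_cases h : ∃ w ∈ A, w ≠ u
  · obtain ⟨w, hw, hwu⟩ := h
    have key : ∀ y : V × V, pr (fun b : V → X => (y.1 ≠ u ∧ y.1 ≠ w ∧ y.2 ≠ u ∧ y.2 ≠ w) ∧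
        f (b y.1) = f (b u) ∧ f (b y.2) = f (b w)) ≤ 1 / k * (1 / k) := fun y => by
      by_cases hy : y.1 ≠ u ∧ y.1 ≠ w ∧ y.2 ≠ u ∧ y.2 ≠ w
      · calc _ ≤ 1 / (k : ℝ) * pr (fun b : V → X => f (b y.2) = f (b w)) := by
              refine pr_le_mul_of_update _ _ u (fun b _ => ?_) fun b x hb => ?_
              · refine (pr_mono fun x hx => ?_).trans (hf (f (b y.1))).le
                have := hx.2.1
                rw [Function.update_self, Function.update_of_ne hy.1] at this
                exact this.symm
              · have := hb.2.2
                rwa [Function.update_of_ne hwu, Function.update_of_ne hy.2.2.1] at this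
          _ ≤ 1 / k * (1 / k) := by gcongr; exact pr_eq_apply_le hf hy.2.2.2
      · refine le_trans (le_of_eq ?_) (by positivity : (0 : ℝ) ≤ 1 / k * (1 / k))
        simp [pr, hy]
    calc _ ≤ pr (fun b : V → X => f (b u) = f (b w) ∨ ∃ y ∈ A ×ˢ A,
            (y.1 ≠ u ∧ y.1 ≠ w ∧ y.2 ≠ u ∧ y.2 ≠ w) ∧
              f (b y.1) = f (b u) ∧ f (b y.2) = f (b w)) := by
          refine pr_mono fun b hb => ?_
          by_cases he : f (b u) = f (b w)
          · exact Or.inl he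
          obtain ⟨i, hi, hiu, hfi⟩ := hb u hu
          obtain ⟨j, hj, hjw, hfj⟩ := hb w hw
          refine Or.inr ⟨(i, j), mem_product.2 ⟨hi, hj⟩, ⟨hiu, ?_, ?_, hjw⟩, hfi, hfj⟩
          · rintro rfl; exact he hfi.symm
          · rintro rfl; exact he hfj
      _ ≤ 1 / k + ∑ y ∈ A ×ˢ A, (1 / k * (1 / k) : ℝ) :=
          (pr_or_le _ _).trans (add_le_add (pr_eq_apply_le hf hwu.symm)
            ((pr_exists_le _ _).trans (sum_le_sum fun y _ => key y)))
      _ = 1 / k + (#A / k : ℝ) ^ 2 := by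
          rw [sum_const, card_product]; simp only [nsmul_eq_mul]; push_cast; ring
  · refine le_trans (le_of_eq ?_) (by positivity : (0 : ℝ) ≤ 1 / k + (#A / k : ℝ) ^ 2)
    have : ∀ b : V → X, ¬ ∀ u ∈ A, ∃ v ∈ A, v ≠ u ∧ f (b v) = f (b u) := fun b hb => by
      obtain ⟨v, hv, hvu, -⟩ := hb u hu
      exact h ⟨v, hv, hvu⟩
    simp [pr, this]

theorem pr_forall_ne_le {l : ℕ} {g : X → Fin l} (hg : ∀ i, pr (fun x => g x = i) = 1 / l)
    (A : Finset V) (j : Fin l) :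
    pr (fun b : V → X => ∀ u ∈ A, g (b u) ≠ j) ≤ (1 - 1 / l : ℝ) ^ #A := by
  have hc : pr (fun x => g x ≠ j) = 1 - 1 / l := by
    rw [← hg j, eq_sub_iff_add_eq]
    unfold pr
    rw [← expect_add_distrib, ← Fintype.expect_const (ι := X) (1 : ℝ)]
    exact expect_congr rfl fun x _ => by by_cases h : g x = j <;> simp [h]
  have hc0 : (0 : ℝ) ≤ 1 - 1 / l := hc ▸ pr_nonneg _
  induction A using Finset.induction_on with
  | empty => simpa using pr_le_one _
  | insert u A hu ih =>
    rw [card_insert_of_notMem hu, pow_succ']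
    refine le_trans (pr_le_mul_of_update _ (fun b : V → X => ∀ u ∈ A, g (b u) ≠ j) u
      (fun b _ => ?_) fun b x hb v hv => ?_) (mul_le_mul_of_nonneg_left ih hc0)
    · refine (pr_mono fun x hx => ?_).trans hc.le
      simpa using hx u (mem_insert_self _ _)
    · have := hb v (mem_insert_of_mem hv)
      rwa [Function.update_of_ne (by rintro rfl; exact hu hv)] at this

theorem pr_exists_forall_ne_le {l : ℕ} {g : X → Fin l}
    (hg : ∀ i, pr (fun x => g x = i) = 1 / l) (A : Finset V) :
    pr (fun b : V → X => ∃ j, ∀ u ∈ A, g (b u) ≠ j) ≤ l * (1 - 1 / l : ℝ) ^ #A := by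
  calc _ = pr (fun b : V → X => ∃ j ∈ (univ : Finset (Fin l)), ∀ u ∈ A, g (b u) ≠ j) :=
        pr_congr fun b => by simp
    _ ≤ ∑ j : Fin l, (1 - 1 / l : ℝ) ^ #A :=
        (pr_exists_le _ _).trans (sum_le_sum fun j _ => pr_forall_ne_le hg A j)
    _ = l * (1 - 1 / l : ℝ) ^ #A := by simp

end BallsIntoBins

/-! ### Failure probability of Green-Decay -/

section GreenDecay

theorem greenDecay_cons_one {m : ℕ} (b : Bool) (c : Fin m → Bool) :
    GreenDecay (Fin.cons b c : Fin (m + 1) → Bool) 1 ↔ b = true := by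
  constructor
  · rintro (h | ⟨j, hj, h, -⟩)
    · omega
    · obtain rfl : j = 0 := Fin.ext (by rw [Fin.val_zero]; omega)
      simpa using h
  · intro h
    exact Or.inr ⟨0, rfl, by simpa using h, fun i hi => absurd hi (Fin.not_lt_zero i)⟩

theorem greenDecay_cons_succ {m : ℕ} (b : Bool) (c : Fin m → Bool) {r : ℕ} (hr : r ≠ 0) :
    GreenDecay (Fin.cons b c : Fin (m + 1) → Bool) (r + 1) ↔ b = false ∧ GreenDecay c r := by
  constructor
  · rintro (h | ⟨j, hj, h, h'⟩)
    · omega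
    · obtain rfl | ⟨i, rfl⟩ := Fin.eq_zero_or_eq_succ j
      · simp at hj; omega
      · refine ⟨by simpa using h' 0 (Fin.succ_pos i), Or.inr ⟨i, by simpa using hj,
          by simpa using h, fun i' hi' => ?_⟩⟩
        simpa using h' i'.succ (Fin.succ_lt_succ_iff.2 hi')
  · rintro ⟨hb, h | ⟨j, hj, h, h'⟩⟩
    · exact absurd h hr
    · refine Or.inr ⟨j.succ, by simpa using hj, by simpa using h, fun i hi => ?_⟩
      obtain rfl | ⟨i, rfl⟩ := Fin.eq_zero_or_eq_succ i
      · simpa using hb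
      · simpa using h' i (Fin.succ_lt_succ_iff.1 hi)

variable {V : Type*}

/-- In no round but the first does exactly one station of `S` transmit. -/
def DecayFails {R : ℕ} (S : Finset V) (c : V → Fin R → Bool) : Prop :=
  ∀ r, r ≠ 0 → r ≤ R → ¬ ∃! u, u ∈ S ∧ GreenDecay (c u) r

/-- Splitting off the first toss of each station. -/
def consTosses (V : Type*) (R : ℕ) :
    (V → Bool) × (V → Fin R → Bool) ≃ (V → Fin (R + 1) → Bool) where
  toFun y v := Fin.cons (y.1 v) (y.2 v)
  invFun c := (fun v => c v 0, fun v => Fin.tail (c v))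
  left_inv y := by simp
  right_inv c := by simp

theorem DecayFails.of_cons {R : ℕ} {S : Finset V} {t : V → Bool} {c : V → Fin R → Bool}
    (h : DecayFails S (consTosses V R (t, c))) :
    (¬ ∃! u, u ∈ S ∧ t u = true) ∧ DecayFails {v ∈ S | t v = false} c := by
  constructor
  · simpa [consTosses, greenDecay_cons_one] using h 1 one_ne_zero (by omega)
  · intro r hr hrR
    simpa [consTosses, greenDecay_cons_succ _ _ hr, and_assoc] using
      h (r + 1) (by omega) (by omega)

variable [Fintype V] [DecidableEq V]

theorem pr_apply_eq_false (u : V) : pr (fun t : V → Bool => t u = false) = 1 / 2 := by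
  unfold pr
  rw [expect_update _ u]
  simp

/-- Flipping the tosses of `S` other than that of `u` is a measure-preserving involution exchanging
the two events. -/
theorem pr_subset_eq_pr_only (S : Finset V) (u : V) :
    pr (fun t : V → Bool => ∀ v ∈ S, (t v = true ↔ v = u)) =
      pr (fun t : V → Bool => ∀ v ∈ S, t v = true) := by
  let f (t : V → Bool) : V → Bool := fun v => if v ∈ S ∧ v ≠ u then !t v else t v
  have hf : Function.Involutive f := fun t => by
    funext v; by_cases h : v ∈ S ∧ v ≠ u <;> simp [f, h]
  rw [← pr_equiv hf.toPerm]
  refine pr_congr fun t => forall₂_congr fun v hv => ?_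
  simp only [Function.Involutive.coe_toPerm, f, hv, true_and]
  by_cases h : v = u <;> simp [h]

/-- With at least two stations, the disjoint events "only `u`" and "only `w`" both have the
probability of "all", and each yields a unique transmitter. With one station, the left-hand event is
empty. -/
theorem two_mul_pr_subset_le (S : Finset V) (hS : S.Nonempty) :
    2 * pr (fun t : V → Bool => (∀ v ∈ S, t v = true) ∧ ¬ ∃! u, u ∈ S ∧ t u = true) ≤
      pr (fun t : V → Bool => ∃! u, u ∈ S ∧ t u = true) := by
  obtain ⟨u, hu⟩ := hS
  by_cases h : ∃ w ∈ S, w ≠ u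
  · obtain ⟨w, hw, hwu⟩ := h
    calc _ ≤ 2 * pr (fun t : V → Bool => ∀ v ∈ S, t v = true) := by
          gcongr; exact pr_mono fun t h => h.1
      _ = pr (fun t : V → Bool => ∀ v ∈ S, (t v = true ↔ v = u)) +
          pr (fun t : V → Bool => ∀ v ∈ S, (t v = true ↔ v = w)) := by
          rw [pr_subset_eq_pr_only, pr_subset_eq_pr_only]; ring
      _ ≤ _ := by
          unfold pr
          rw [← expect_add_distrib]
          refine expect_le_expect fun t _ => ?_
          have hex : ∀ z ∈ S, (∀ v ∈ S, (t v = true ↔ v = z)) → ∃! u, u ∈ S ∧ t u = true :=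
            fun z hz hh => ⟨z, ⟨hz, (hh z hz).2 rfl⟩, fun v hv => (hh v hv.1).1 hv.2⟩
          by_cases h1 : ∀ v ∈ S, (t v = true ↔ v = u)
          · have h2 : ¬ ∀ v ∈ S, (t v = true ↔ v = w) := fun h2 =>
              hwu ((h1 w hw).1 ((h2 w hw).2 rfl))
            rw [if_pos h1, if_neg h2, if_pos (hex u hu h1)]; norm_num
          · rw [if_neg h1]
            by_cases h2 : ∀ v ∈ S, (t v = true ↔ v = w)
            · rw [if_pos h2, if_pos (hex w hw h2)]; norm_num
            · rw [if_neg h2]; split_ifs <;> norm_num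
  · have : ∀ t : V → Bool, ¬ ((∀ v ∈ S, t v = true) ∧ ¬ ∃! u, u ∈ S ∧ t u = true) :=
      fun t ht => ht.2 ⟨u, ⟨hu, ht.1 u hu⟩, fun v hv => by_contra fun hvu => h ⟨v, hv.1, hvu⟩⟩
    refine le_trans (le_of_eq ?_) (pr_nonneg _)
    simp only [pr, this, if_false, expect_const_zero, mul_zero]

theorem expect_card_filter (S : Finset V) :
    𝔼 t : V → Bool, (#{v ∈ S | t v = false} : ℝ) = #S / 2 := by
  have : ∀ t : V → Bool, (#{v ∈ S | t v = false} : ℝ) =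
      ∑ v ∈ S, if t v = false then (1 : ℝ) else 0 := fun t => by
    rw [card_filter]; push_cast; rfl
  simp only [this]
  rw [expect_sum_comm]
  have h : ∀ v : V, 𝔼 t : V → Bool, (if t v = false then (1 : ℝ) else 0) = 1 / 2 := fun v => by
    rw [expect_ite_eq_pr, pr_apply_eq_false]
  simp only [h, sum_const, nsmul_eq_mul]
  ring

-- Induction on the tosses, conditioning on the first toss of every station. A unique 1 is a
-- success; otherwise the stations with toss 0 carry on. The term `#S / 2 ^ R` is for stations
-- surviving all tosses, and the last term makes the bound at least 1 for empty `S`. The only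
-- harmful move, in which at least two stations all stop together, has at most half the probability
-- of an immediate success, so the loss 2/3 is balanced by the gain 1/3.
open Classical in
theorem pr_decayFails_le (R : ℕ) (S : Finset V) :
    pr (fun c : V → Fin R → Bool => DecayFails S c) ≤
      1 / 3 + #S / 2 ^ R + (if S = ∅ then 2 / 3 else 0) := by
  induction R generalizing S with
  | zero =>
    refine (pr_le_one _).trans ?_
    rcases S.eq_empty_or_nonempty with rfl | hS
    · norm_num
    · have : (1 : ℝ) ≤ #S := by exact_mod_cast hS.card_pos
      rw [if_neg hS.ne_empty]; norm_num; linarith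
  | succ R ih =>
    rcases S.eq_empty_or_nonempty with rfl | hS
    · refine (pr_le_one _).trans ?_
      norm_num
    rw [if_neg hS.ne_empty, ← pr_equiv (consTosses V R), pr_prod]
    have key : ∀ t : V → Bool,
        pr (fun c => DecayFails S (consTosses V R (t, c))) ≤
          1 / 3 + (#{v ∈ S | t v = false} : ℝ) * (1 / 2 ^ R) +
          ((2 / 3) * (if (∀ v ∈ S, t v = true) ∧ ¬ ∃! u, u ∈ S ∧ t u = true then (1 : ℝ) else 0)
            - (1 / 3) * (if ∃! u, u ∈ S ∧ t u = true then (1 : ℝ) else 0)) := fun t => by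
      by_cases hu : ∃! u, u ∈ S ∧ t u = true
      · have : ∀ c, ¬ DecayFails S (consTosses V R (t, c)) := fun c hc => hc.of_cons.1 hu
        simp only [pr, this, if_false, expect_const_zero, hu, not_true, and_false, if_true]
        have : (0 : ℝ) ≤ (#{v ∈ S | t v = false} : ℝ) * (1 / 2 ^ R) := by positivity
        linarith
      -- Without a unique transmitter, the set of survivors is empty exactly when all tosses are 1,
      -- which brings in the extra 2/3 of the induction hypothesis.
      · refine (pr_mono fun c hc => hc.of_cons.2).trans ((ih _).trans (le_of_eq ?_))
        have : ({v ∈ S | t v = false} = ∅) ↔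
            ((∀ v ∈ S, t v = true) ∧ ¬ ∃! u, u ∈ S ∧ t u = true) := by
          simp [filter_eq_empty_iff, hu]
        simp only [this, hu, if_false]
        split_ifs <;> ring
    refine (expect_le_expect fun t _ => key t).trans ?_
    rw [expect_add_distrib, expect_add_distrib, expect_sub_distrib, ← mul_expect, ← mul_expect,
      ← expect_mul, expect_card_filter, Fintype.expect_const]
    have h2 := two_mul_pr_subset_le S hS
    rw [expect_ite_eq_pr fun t : V → Bool =>
        (∀ v ∈ S, t v = true) ∧ ¬ ∃! u, u ∈ S ∧ t u = true,
      expect_ite_eq_pr fun t : V → Bool => ∃! u, u ∈ S ∧ t u = true]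
    have h3 : (#S : ℝ) / 2 * (1 / 2 ^ R) = #S / 2 ^ (R + 1) := by
      rw [pow_succ]; field_simp
    linarith

end GreenDecay

/-! ### Numerical estimates for the parameters -/

section Parameters

variable {n : ℕ}

theorem five_le_logb (hn : 32 ≤ n) : (5 : ℝ) ≤ Real.logb 2 n := by
  rw [Real.le_logb_iff_rpow_le (by norm_num) (by positivity)]
  norm_num
  exact hn

theorem two_lt_logb_logb (hn : 32 ≤ n) : (2 : ℝ) < Real.logb 2 (Real.logb 2 n) := by
  have := five_le_logb hn
  rw [Real.lt_logb_iff_rpow_lt (by norm_num) (by linarith)]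
  norm_num
  linarith

theorem three_le_ll (hn : 32 ≤ n) : 3 ≤ ll n :=
  Nat.lt_ceil.2 (by exact_mod_cast two_lt_logb_logb hn)

theorem le_two_pow_logCeil (hn : 32 ≤ n) : n ≤ 2 ^ logCeil n := by
  have h : Real.logb 2 n ≤ logCeil n := Nat.le_ceil _
  rw [Real.logb_le_iff_le_rpow (by norm_num) (by positivity), Real.rpow_natCast] at h
  exact_mod_cast h

theorem five_le_logCeil (hn : 32 ≤ n) : 5 ≤ logCeil n := by
  have h : Real.logb 2 n ≤ logCeil n := Nat.le_ceil _
  exact_mod_cast (five_le_logb hn).trans h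

theorem two_pow_ll_le (hn : 32 ≤ n) : 2 ^ ll n ≤ 2 * logCeil n := by
  have h5 := five_le_logb hn
  have h1 : (ll n : ℝ) < Real.logb 2 (Real.logb 2 n) + 1 :=
    Nat.ceil_lt_add_one (by linarith [two_lt_logb_logb hn])
  have h2 : (2 : ℝ) ^ (ll n : ℝ) ≤ 2 ^ (Real.logb 2 (Real.logb 2 n) + 1) :=
    Real.rpow_le_rpow_of_exponent_le (by norm_num) h1.le
  rw [Real.rpow_add (by norm_num), Real.rpow_logb (by norm_num) (by norm_num) (by linarith),
    Real.rpow_natCast, Real.rpow_one] at h2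
  have h3 : Real.logb 2 n ≤ logCeil n := Nat.le_ceil _
  have : (2 : ℝ) ^ ll n ≤ 2 * logCeil n := by linarith
  exact_mod_cast this

theorem twelve_mul_two_pow_ll_le (hn : 32 ≤ n) : 12 * 2 ^ ll n ≤ k n := by
  have := two_pow_ll_le hn
  unfold k
  omega

theorem k_pos (n : ℕ) : 0 < k n := Nat.succ_pos _

theorem phaseLength_pos (n : ℕ) : 0 < phaseLength n := Nat.mul_pos (by norm_num) (k_pos n)

/-- The constant 33 is what `few_balls_bound` can afford: `1/12 + 33/36 = 1`. -/
theorem pow_four_le (l : ℕ) : l ^ 4 ≤ 33 * 2 ^ l := by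
  rcases Nat.lt_or_ge l 6 with h | h
  · interval_cases l <;> norm_num
  · induction l, h using Nat.le_induction with
    | base => norm_num
    | succ l hl ih =>
      have : (l + 1) ^ 4 ≤ 2 * l ^ 4 := by
        obtain ⟨i, rfl⟩ := Nat.exists_eq_add_of_le hl
        ring_nf
        nlinarith [sq_nonneg i, pow_nonneg (Nat.zero_le i) 3, pow_nonneg (Nat.zero_le i) 4]
      rw [pow_succ 2]
      omega

theorem few_balls_bound (hn : 32 ≤ n) {m : ℕ} (hm : m ≤ 2 * ll n ^ 2) :
    1 / (k n : ℝ) + (m / k n : ℝ) ^ 2 ≤ 1 / 2 ^ ll n := by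
  set l := ll n
  have hk : (12 * 2 ^ l : ℝ) ≤ k n := by exact_mod_cast twelve_mul_two_pow_ll_le hn
  have hl : (l ^ 4 : ℝ) ≤ 33 * 2 ^ l := by exact_mod_cast pow_four_le l
  have hm' : (m : ℝ) ≤ 2 * l ^ 2 := by exact_mod_cast hm
  have hp : (0 : ℝ) < 2 ^ l := by positivity
  calc 1 / (k n : ℝ) + (m / k n : ℝ) ^ 2
      ≤ 1 / (12 * 2 ^ l) + (2 * (l : ℝ) ^ 2 / (12 * 2 ^ l)) ^ 2 := by gcongr
    _ = 1 / 2 ^ l * (1 / 12 + (l : ℝ) ^ 4 / (36 * 2 ^ l)) := by field_simp; ring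
    _ ≤ 1 / 2 ^ l * (1 / 12 + 33 * 2 ^ l / (36 * 2 ^ l)) := by gcongr
    _ = 1 / 2 ^ l := by field_simp; norm_num

/-- Bounding the factor `l` by `2^l` and using `(1 - 1/l)^l ≤ e⁻¹ < 0.37` leaves `(4 · 0.37²)^l`,
whose base is below 1, so `l = 3` is the worst case. -/
theorem many_balls_bound {l m : ℕ} (hl : 3 ≤ l) (hm : 2 * l ^ 2 ≤ m) :
    2 ^ l * (l * (1 - 1 / l : ℝ) ^ m) ≤ 1 / 5 := by
  have hl' : (3 : ℝ) ≤ l := by exact_mod_cast hl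
  have h0 : (0 : ℝ) ≤ 1 - 1 / l := by
    rw [sub_nonneg, div_le_one (by linarith)]; linarith
  have h1 : (1 - 1 / l : ℝ) ≤ 1 := by
    have : (0 : ℝ) ≤ 1 / l := by positivity
    linarith
  have he : (1 - 1 / l : ℝ) ^ l ≤ 37 / 100 := by
    calc (1 - 1 / l : ℝ) ^ l ≤ (Real.exp (-(1 / l))) ^ l := by
          gcongr
          linarith [Real.add_one_le_exp (-(1 / l : ℝ))]
      _ = Real.exp (-1) := by
          rw [← Real.exp_nat_mul]; congr 1; field_simp
      _ ≤ 37 / 100 := by linarith [Real.exp_neg_one_lt_d9]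
  calc 2 ^ l * (l * (1 - 1 / l : ℝ) ^ m)
      ≤ 2 ^ l * (2 ^ l * (1 - 1 / l : ℝ) ^ (2 * l ^ 2)) := by
        gcongr 2 ^ l * (?_ * ?_)
        · exact_mod_cast Nat.lt_two_pow_self.le
        · exact pow_le_pow_of_le_one h0 h1 hm
    _ = (4 * ((1 - 1 / l : ℝ) ^ l) ^ 2) ^ l := by
        rw [mul_pow, ← pow_mul, ← pow_mul, ← mul_assoc, ← mul_pow]; norm_num; ring_nf
    _ ≤ (4 * (37 / 100) ^ 2) ^ l := by gcongr
    _ ≤ (4 * (37 / 100) ^ 2) ^ 3 := pow_le_pow_of_le_one (by norm_num) (by norm_num) hl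
    _ ≤ 1 / 5 := by norm_num

/-- Here `k - 1 = 24L` and `m ≤ 2^L`, so the second term is at most `2^(-23L)`, far below `2/5 -
1/3`. -/
theorem decay_bound (hn : 32 ≤ n) {m : ℕ} (hm : m ≤ n) :
    (1 / 3 : ℝ) + m / 2 ^ (k n - 1) ≤ 2 / 5 := by
  have hk : k n - 1 = logCeil n + 23 * logCeil n := by unfold k; omega
  have h1 : (m : ℝ) ≤ 2 ^ logCeil n := by exact_mod_cast hm.trans (le_two_pow_logCeil hn)
  have h2 : (2 : ℝ) ^ 4 ≤ 2 ^ (23 * logCeil n) :=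
    pow_le_pow_right₀ (by norm_num) (by have := five_le_logCeil hn; omega)
  have : (m : ℝ) / 2 ^ (k n - 1) ≤ 1 / 16 := by
    rw [hk, pow_add, div_le_div_iff₀ (by positivity) (by norm_num)]
    nlinarith [pow_pos (two_pos : (0 : ℝ) < 2) (logCeil n)]
  linarith

end Parameters

/-! ### Success probability of a single phase -/

section OnePhase

variable {V : Type*} {n : ℕ}

theorem pr_fst_eq {α β : Type*} [Fintype α] [Fintype β] [Nonempty β] {m : ℕ} (f : α ≃ Fin m × β)
    (i : Fin m) : pr (fun x => (f x).1 = i) = 1 / m := by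
  rw [pr_equiv f (fun y => y.1 = i), pr_prod]
  have : ∀ a : Fin m, pr (fun _ : β => a = i) = if a = i then (1 : ℝ) else 0 := fun a => by
    unfold pr; rw [Fintype.expect_const]; split_ifs <;> rfl
  simp only [this]
  rw [Fintype.expect_eq_sum_div_card]
  simp

theorem pr_draw_bin (hn : 32 ≤ n) (i : Fin (k n)) :
    pr (fun d : Draw n => d.1 = i) = 1 / k n :=
  have : Nonempty (Fin (ll n)) := ⟨⟨0, ll_pos hn⟩⟩
  pr_fst_eq (Equiv.refl (Draw n)) i

theorem pr_draw_phase (j : Fin (ll n)) :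
    pr (fun d : Draw n => d.2.1 = j) = 1 / ll n := by
  have : Nonempty (Fin (k n)) := ⟨⟨0, k_pos n⟩⟩
  let f : Draw n ≃ Fin (ll n) × (Fin (k n) × (Fin (k n - 1) → Bool)) :=
    { toFun := fun d => (d.2.1, d.1, d.2.2)
      invFun := fun y => (y.2.1, y.1, y.2.2)
      left_inv := fun _ => rfl
      right_inv := fun _ => rfl }
  exact pr_fst_eq f j

/-- Conditioning on all choices except the coin tosses. -/
theorem pr_le_of_tosses [Fintype V] [DecidableEq V] (hn : 32 ≤ n) (p : (V → Draw n) → Prop) {c : ℝ}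
    (h : ∀ a : V → Fin (k n) × Fin (ll n),
      pr (fun b : V → Fin (k n - 1) → Bool => p fun v => ((a v).1, (a v).2, b v)) ≤ c) :
    pr p ≤ c := by
  have : Nonempty (Fin (ll n)) := ⟨⟨0, ll_pos hn⟩⟩
  have : Nonempty (Fin (k n)) := ⟨⟨0, k_pos n⟩⟩
  let f : (V → Fin (k n) × Fin (ll n)) × (V → Fin (k n - 1) → Bool) ≃ (V → Draw n) :=
    { toFun := fun y v => ((y.1 v).1, (y.1 v).2, y.2 v)
      invFun := fun e => (fun v => ((e v).1, (e v).2.1), fun v => (e v).2.2)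
      left_inv := fun _ => rfl
      right_inv := fun _ => rfl }
  rw [← pr_equiv f]
  exact pr_prod_le _ h

/-- In no round of phase `q` does exactly one station of `S` transmit. -/
def PhaseFails (q : ℕ) (m : V → Memory) (S : Finset V) (e : V → Draw n) : Prop :=
  ∀ r < phaseLength n, ¬ ∃! u, u ∈ S ∧ TransmitsInPhase q (m u) (e u) r

theorem transmitsInPhase_third {q : ℕ} {m : Memory} {d : Draw n} {r : ℕ} :
    TransmitsInPhase q m d (2 * k n + r) ↔
      (m.next q d).myPhase = some (phase n q) ∧ GreenDecay d.2.2 r := by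
  have := d.1.isLt
  unfold TransmitsInPhase
  rw [Nat.add_sub_cancel_left]
  constructor
  · rintro (h | h | h)
    · omega
    · omega
    · exact ⟨h.1, h.2.2⟩
  · rintro ⟨h, h'⟩
    exact Or.inr (Or.inr ⟨h, by omega, h'⟩)

/-- Once slots and `myPhase` values are fixed, the set `T` of stations running Green-Decay is
determined; only their tosses remain random, and they alone use the third block. -/
theorem pr_phaseFails_and_le [Fintype V] [DecidableEq V] (hn : 32 ≤ n) (hV : Fintype.card V = n) (q : ℕ) (m : V → Memory)
    (S : Finset V) :
    pr (fun e : V → Draw n => PhaseFails q m S e ∧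
      ∃ u ∈ S, ((m u).next q (e u)).myPhase = some (phase n q)) ≤ 2 / 5 := by
  classical
  refine pr_le_of_tosses hn _ fun a => ?_
  let T : Finset V := {u ∈ S | (if phase n q = 0 ∨ StillNew n q (m u) then
    some ((a u).2 : ℕ) else (m u).myPhase) = some (phase n q)}
  by_cases hT : T = ∅
  · refine le_trans (le_of_eq ?_) (by norm_num : (0 : ℝ) ≤ 2 / 5)
    have : ∀ b : V → Fin (k n - 1) → Bool, ¬ ∃ u ∈ S,
        ((m u).next q (((a u).1, (a u).2, b u) : Draw n)).myPhase = some (phase n q) := by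
      rintro b ⟨u, hu, h⟩
      have : u ∈ T := mem_filter.2 ⟨hu, by simpa only [Memory.next] using h⟩
      simp [hT] at this
    simp only [pr, this, and_false, if_false, expect_const_zero]
  · calc _ ≤ pr (fun b : V → Fin (k n - 1) → Bool => DecayFails T b) := by
          refine pr_mono fun b hb r hr hrR hex => ?_
          refine hb.1 (2 * k n + r) (by unfold phaseLength; omega) ?_
          refine (existsUnique_congr fun u => ?_).1 hex
          rw [transmitsInPhase_third, mem_filter, and_assoc]
          rfl
      _ ≤ 1 / 3 + #T / 2 ^ (k n - 1) := by
          have := pr_decayFails_le (k n - 1) T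
          rwa [if_neg hT, add_zero] at this
      _ ≤ 2 / 5 := decay_bound hn (hV ▸ card_le_univ T)

/-- The stations of `S` that choose `myPhase` in phase `q`. -/
noncomputable def choosers (n q : ℕ) (m : V → Memory) (S : Finset V) : Finset V :=
  {u ∈ S | phase n q = 0 ∨ (m u).isNew = true}

/-- All choosers use the same block, the second if `phase = 0` and the first otherwise, and no other
station of `S` transmits there. A chooser alone in its slot would be a unique transmitter. -/
theorem PhaseFails.bins {q : ℕ} {m : V → Memory} {S : Finset V} {e : V → Draw n}
    (h : PhaseFails q m S e) :
    ∀ u ∈ choosers n q m S, ∃ v ∈ choosers n q m S, v ≠ u ∧ (e v).1 = (e u).1 := by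
  classical
  intro u hu
  by_contra hcon
  push Not at hcon
  have hlt := fun v => (e v).1.isLt
  simp only [choosers, mem_filter, and_imp] at hu hcon
  by_cases hq : phase n q = 0
  · refine h (k n + (e u).1) (by have := hlt u; unfold phaseLength; omega) ⟨u, ⟨hu.1, ?_⟩, ?_⟩
    · exact Or.inr (Or.inl ⟨fun h => h.2 hq, hq, rfl⟩)
    · rintro v ⟨hv, h1 | h1 | h1⟩
      · exact absurd hq h1.1.2
      · by_contra hvu
        exact hcon v hv (Or.inl hq) hvu (Fin.ext (by omega))
      · have := hlt u
        omega
  · have hu' : (m u).isNew = true := hu.2.resolve_left hq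
    refine h (e u).1 (by have := hlt u; unfold phaseLength; omega) ⟨u, ⟨hu.1, ?_⟩, ?_⟩
    · exact Or.inl ⟨⟨hu', hq⟩, rfl⟩
    · rintro v ⟨hv, h1 | h1 | h1⟩
      · by_contra hvu
        exact hcon v hv (Or.inr h1.1.1) hvu (Fin.ext (by omega))
      · exact absurd h1.2.1 hq
      · have := hlt u
        omega

-- The values 1 and `2^(ll-1)` bound the weight after the phase: drawing every value of `myPhase`
-- makes the neighbourhood ready. The split at `2 ll²` choosers separates the range where isolation
-- in a bin fails with probability at most `2^(-ll)` from the range where a missing value of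
-- `myPhase` contributes at most 1/10.
open Classical in
theorem expect_phaseFails_le [Fintype V] [DecidableEq V] (hn : 32 ≤ n) (hV : Fintype.card V = n) (q : ℕ) (m : V → Memory)
    (S : Finset V) (hS : (choosers n q m S).Nonempty) :
    𝔼 e : V → Draw n, (if PhaseFails q m S e then
      if ∀ j : Fin (ll n), ∃ u ∈ choosers n q m S, (e u).2.1 = j then (1 : ℝ)
        else 2 ^ (ll n - 1) else 0) ≤ 1 / 2 := by
  have := nonempty_draw hn
  have hl := three_le_ll hn
  have hpow : (2 : ℝ) ^ ll n = 2 * 2 ^ (ll n - 1) := by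
    rw [← pow_succ']; congr 1; omega
  have h1 : (1 : ℝ) ≤ 2 ^ (ll n - 1) := one_le_pow₀ (by norm_num)
  set A := choosers n q m S
  rcases le_total #A (2 * ll n ^ 2) with h | h
  · calc _ ≤ 𝔼 e : V → Draw n, 2 ^ (ll n - 1) *
          (if ∀ u ∈ A, ∃ v ∈ A, v ≠ u ∧ (e v).1 = (e u).1 then (1 : ℝ) else 0) := by
          refine expect_le_expect fun e _ => ?_
          by_cases hf : PhaseFails q m S e
          · rw [if_pos hf, if_pos hf.bins, mul_one]; split_ifs <;> linarith
          · rw [if_neg hf]; positivity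
      _ = 2 ^ (ll n - 1) *
          pr (fun e : V → Draw n => ∀ u ∈ A, ∃ v ∈ A, v ≠ u ∧ (e v).1 = (e u).1) := by
          rw [← mul_expect, expect_ite_eq_pr]
      _ ≤ 2 ^ (ll n - 1) * (1 / 2 ^ ll n) := by
          gcongr
          exact (pr_no_singleton_le (pr_draw_bin hn) hS).trans (few_balls_bound hn h)
      _ = 1 / 2 := by rw [hpow]; field_simp
  · calc _ ≤ 𝔼 e : V → Draw n, ((if PhaseFails q m S e ∧
            ∃ u ∈ S, ((m u).next q (e u)).myPhase = some (phase n q) then (1 : ℝ) else 0) +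
          2 ^ (ll n - 1) * (if ∃ j, ∀ u ∈ A, (e u).2.1 ≠ j then (1 : ℝ) else 0)) := by
          refine expect_le_expect fun e _ => ?_
          by_cases hf : PhaseFails q m S e
          · by_cases hj : ∀ j : Fin (ll n), ∃ u ∈ A, (e u).2.1 = j
            -- If every value is drawn, so is the current phase, and its chooser runs Green-Decay at
            -- once.
            · obtain ⟨u, hu, hju⟩ := hj ⟨q % ll n, Nat.mod_lt _ (ll_pos hn)⟩
              have hu' := mem_filter.1 hu
              have : ∃ u ∈ S, ((m u).next q (e u)).myPhase = some (phase n q) := by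
                refine ⟨u, hu'.1, ?_⟩
                have hc : phase n q = 0 ∨ StillNew n q (m u) := by
                  by_cases hq : phase n q = 0
                  · exact Or.inl hq
                  · exact Or.inr ⟨hu'.2.resolve_left hq, hq⟩
                simp only [Memory.next]; rw [if_pos hc, hju]; rfl
              rw [if_pos hf, if_pos hj, if_pos ⟨hf, this⟩]
              have : (0 : ℝ) ≤ 2 ^ (ll n - 1) *
                (if ∃ j, ∀ u ∈ A, (e u).2.1 ≠ j then (1 : ℝ) else 0) := by positivity
              linarith
            · have hj' : ∃ j, ∀ u ∈ A, (e u).2.1 ≠ j := by push Not at hj; exact hj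
              rw [if_pos hf, if_neg hj, if_pos hj', mul_one]
              have : (0 : ℝ) ≤ (if PhaseFails q m S e ∧
                ∃ u ∈ S, ((m u).next q (e u)).myPhase = some (phase n q) then (1 : ℝ) else 0) := by
                positivity
              linarith
          · rw [if_neg hf]; positivity
      _ = pr (fun e : V → Draw n => PhaseFails q m S e ∧
            ∃ u ∈ S, ((m u).next q (e u)).myPhase = some (phase n q)) +
          2 ^ (ll n - 1) * pr (fun e : V → Draw n => ∃ j, ∀ u ∈ A, (e u).2.1 ≠ j) := by
          rw [expect_add_distrib, ← mul_expect, expect_ite_eq_pr, expect_ite_eq_pr]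
      _ ≤ 2 / 5 + 2 ^ (ll n - 1) * (ll n * (1 - 1 / ll n : ℝ) ^ #A) := by
          gcongr
          · exact pr_phaseFails_and_le hn hV q m S
          · exact pr_exists_forall_ne_le (g := fun d : Draw n => d.2.1) pr_draw_phase A
      _ ≤ 1 / 2 := by
          have := many_balls_bound hl h
          rw [hpow] at this
          linarith

end OnePhase

/-! ### Reception, active neighbourhoods and their weight -/

section Network

variable {V : Type*} {n : ℕ} (G : SimpleGraph V) (s : V)

theorem firstPhase_le_iff {τ q : ℕ} : firstPhase n τ ≤ q ↔ τ ≤ phaseLength n * q := by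
  have := phaseLength_pos n
  unfold firstPhase
  rw [← Nat.lt_succ_iff, Nat.div_lt_iff_lt_mul this, Nat.succ_mul, mul_comm]
  omega

theorem memory_congr {x y : ℕ → Draw n} {p i : ℕ} (h : ∀ j < p + i, x j = y j) :
    memory x p i = memory y p i := by
  induction i with
  | zero => rfl
  | succ i ih =>
    simp only [memory]
    rw [ih fun j hj => h j (by omega), h (p + i) (by omega)]

theorem stationTransmits_congr {x y : ℕ → Draw n} {τ t : ℕ}
    (h : ∀ j ≤ t / phaseLength n, x j = y j) :
    StationTransmits x τ t ↔ StationTransmits y τ t := by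
  unfold StationTransmits
  refine and_congr_right fun hp => and_congr_right fun _ => ?_
  rw [h _ le_rfl, memory_congr (y := y) fun j hj => h j (by omega)]

theorem receptionTime_succ_of_some {ω : ℕ → V → Draw n} {t τ : ℕ} {v : V}
    (h : receptionTime G s ω t v = some τ) : receptionTime G s ω (t + 1) v = some τ := by
  simp only [receptionTime, h]

theorem receptionTime_of_le {ω : ℕ → V → Draw n} {t t' τ : ℕ} {v : V}
    (h : receptionTime G s ω t v = some τ) (ht : t ≤ t') :
    receptionTime G s ω t' v = some τ := by
  induction t', ht using Nat.le_induction with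
  | base => exact h
  | succ t' _ ih => exact receptionTime_succ_of_some G s ih

theorem receptionTime_self {ω : ℕ → V → Draw n} {t τ : ℕ} {v : V}
    (h : receptionTime G s ω t v = some τ) : τ ≤ t ∧ receptionTime G s ω τ v = some τ := by
  induction t with
  | zero =>
    have h0 := h
    simp only [receptionTime] at h
    split_ifs at h
    obtain rfl : 0 = τ := by simpa using h
    exact ⟨le_rfl, h0⟩
  | succ t ih =>
    rcases h1 : receptionTime G s ω t v with _ | τ'
    · have h0 := h
      simp only [receptionTime, h1] at h
      split_ifs at h
      obtain rfl : t + 1 = τ := by simpa using h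
      exact ⟨le_rfl, h0⟩
    · have := receptionTime_succ_of_some G s h1
      rw [h] at this
      obtain ⟨h2, h3⟩ := ih (h1.trans this.symm)
      exact ⟨h2.trans t.le_succ, h3⟩

theorem receptionTime_eq_some_iff {ω : ℕ → V → Draw n} {t t' τ : ℕ} {v : V} (h : τ ≤ t)
    (h' : τ ≤ t') :
    receptionTime G s ω t v = some τ ↔ receptionTime G s ω t' v = some τ :=
  ⟨fun hr => receptionTime_of_le G s (receptionTime_self G s hr).2 h',
    fun hr => receptionTime_of_le G s (receptionTime_self G s hr).2 h⟩

-- The state at the beginning of phase `q` is determined by the choices of the earlier phases; this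
-- makes every process below adapted.
open Classical in
theorem receptionTime_congr {ω ω' : ℕ → V → Draw n} {q t : ℕ} (ht : t ≤ phaseLength n * q)
    (h : ∀ i < q, ω i = ω' i) : receptionTime G s ω t = receptionTime G s ω' t := by
  induction t with
  | zero => rfl
  | succ t ih =>
    have ih := ih (by omega)
    funext v
    have hq : t / phaseLength n < q := by
      rw [Nat.div_lt_iff_lt_mul (phaseLength_pos n), mul_comm]; omega
    have hst : ∀ u τ, StationTransmits (fun q => ω q u) τ t ↔
        StationTransmits (fun q => ω' q u) τ t := fun u τ =>
      stationTransmits_congr fun j hj => by rw [h j (hj.trans_lt hq)]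
    simp only [receptionTime, ih]
    rcases receptionTime G s ω' t v with _ | τ
    · exact if_congr (existsUnique_congr fun u => by simp only [hst]) rfl rfl
    · rfl

/-- The first phase of `v`, if `v` has the message at the beginning of phase `q`. -/
noncomputable def entry (ω : ℕ → V → Draw n) (q : ℕ) (v : V) : Option ℕ :=
  (receptionTime G s ω (phaseLength n * q) v).map (firstPhase n)

/-- The variables of `v` at the beginning of phase `q`, if it has the message. -/
noncomputable def mem (ω : ℕ → V → Draw n) (q : ℕ) (v : V) : Memory :=
  memory (fun i => ω i v) ((entry G s ω q v).getD 0) (q - (entry G s ω q v).getD 0)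

variable {G s} {ω ω' : ℕ → V → Draw n} {q q' p : ℕ} {u v w : V}

theorem entry_congr (h : ∀ i < q, ω i = ω' i) : entry G s ω q = entry G s ω' q := by
  funext v
  unfold entry
  rw [receptionTime_congr G s le_rfl h]

theorem entry_le (h : entry G s ω q v = some p) : p ≤ q := by
  obtain ⟨τ, hτ, rfl⟩ := Option.map_eq_some_iff.1 h
  exact firstPhase_le_iff.2 (receptionTime_self G s hτ).1

theorem mem_congr (h : ∀ i < q, ω i = ω' i) : mem G s ω q = mem G s ω' q := by
  funext v
  unfold mem
  rw [entry_congr h]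
  refine memory_congr fun j hj => ?_
  rw [h j]
  rcases he : entry G s ω' q v with _ | p
  · simp [he] at hj; omega
  · have := entry_le he
    simp [he] at hj; omega

theorem entry_eq_of_le (h : entry G s ω q v = some p) (hq' : p ≤ q') :
    entry G s ω q' v = some p := by
  obtain ⟨τ, hτ, rfl⟩ := Option.map_eq_some_iff.1 h
  exact Option.map_eq_some_iff.2 ⟨τ, (receptionTime_eq_some_iff G s
    (receptionTime_self G s hτ).1 (firstPhase_le_iff.1 hq')).1 hτ, rfl⟩

theorem entry_succ (h : entry G s ω q v = some p) : entry G s ω (q + 1) v = some p :=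
  entry_eq_of_le h ((entry_le h).trans q.le_succ)

theorem entry_eq_succ (h : entry G s ω q v = none) (h' : entry G s ω (q + 1) v = some p) :
    p = q + 1 := by
  have := entry_le h'
  by_contra hp
  rw [entry_eq_of_le h' (by omega : p ≤ q)] at h
  cases h

theorem entry_zero : entry G s ω 0 s = some 0 := by
  have : phaseLength n - 1 < phaseLength n := Nat.sub_lt (phaseLength_pos n) one_pos
  simp [entry, receptionTime, firstPhase, this]

theorem mem_succ (h : entry G s ω q v = some p) :
    mem G s ω (q + 1) v = (mem G s ω q v).next q (ω q v) := by
  have hp := entry_le h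
  unfold mem
  rw [entry_succ h, h]
  simp only [Option.getD_some]
  rw [Nat.succ_sub hp]
  simp only [memory]
  rw [Nat.add_sub_cancel' hp]

theorem mem_isNew_of_entry (h : entry G s ω q v = some q) : (mem G s ω q v).isNew = true := by
  unfold mem
  simp [h, memory]

variable [Fintype V]

open Classical in
/-- The neighbours of `w` that have the message at the beginning of phase `q`. -/
noncomputable def nbrs (G : SimpleGraph V) (s : V) (ω : ℕ → V → Draw n) (q : ℕ) (w : V) :
    Finset V := {u | G.Adj w u ∧ entry G s ω q u ≠ none}

theorem mem_nbrs : u ∈ nbrs G s ω q w ↔ G.Adj w u ∧ entry G s ω q u ≠ none := by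
  simp [nbrs]

theorem mem_nbrs_iff : u ∈ nbrs G s ω q w ↔ G.Adj w u ∧ ∃ p, entry G s ω q u = some p := by
  rw [mem_nbrs, Option.ne_none_iff_exists']

theorem nbrs_congr (h : ∀ i < q, ω i = ω' i) : nbrs G s ω q = nbrs G s ω' q := by
  funext w
  unfold nbrs
  rw [entry_congr h]

theorem nbrs_subset_succ : nbrs G s ω q w ⊆ nbrs G s ω (q + 1) w := fun u hu => by
  rw [mem_nbrs_iff] at hu ⊢
  exact ⟨hu.1, hu.2.imp fun p hp => entry_succ hp⟩

/-- The largest number of iterations made by an informed neighbour of `w` before phase `q`. -/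
noncomputable def age (G : SimpleGraph V) (s : V) (ω : ℕ → V → Draw n) (q : ℕ) (w : V) : ℕ :=
  (nbrs G s ω q w).sup fun u => q - (entry G s ω q u).getD 0

theorem age_congr (h : ∀ i < q, ω i = ω' i) : age G s ω q = age G s ω' q := by
  funext w
  unfold age
  rw [nbrs_congr h, entry_congr h]

/-- Stations informed during phase `q` wait for the next phase, and the bound on `age` excludes
neighbours that have terminated. Hence the neighbours transmitting in a round of phase `q` are
exactly those of `nbrs` prescribed by `TransmitsInPhase`, and a unique one would inform `w`. -/
theorem phaseFails_of_entry_eq_none (hw : entry G s ω (q + 1) w = none)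
    (hage : age G s ω q w < iterations n) :
    PhaseFails q (mem G s ω q) (nbrs G s ω q w) (ω q) := by
  intro r hr hex
  have hP := phaseLength_pos n
  set t := phaseLength n * q + r with ht
  have hdiv : t / phaseLength n = q := by
    rw [ht, Nat.mul_add_div hP, Nat.div_eq_of_lt hr, add_zero]
  have hmod : t % phaseLength n = r := by
    rw [ht, Nat.mul_add_mod, Nat.mod_eq_of_lt hr]
  have hnone : ∀ t' ≤ phaseLength n * (q + 1), receptionTime G s ω t' w = none := fun t' h' => by
    by_contra hne
    obtain ⟨τ, hτ⟩ := Option.ne_none_iff_exists'.1 hne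
    simp [entry, receptionTime_of_le G s hτ h'] at hw
  have h1 := hnone (t + 1) (by rw [mul_add]; omega)
  have h2 := hnone t (by rw [mul_add]; omega)
  simp only [receptionTime, h2] at h1
  refine (?_ : ¬ ∃! u, G.Adj w u ∧ ∃ τ, receptionTime G s ω t u = some τ ∧
    StationTransmits (fun q => ω q u) τ t) ((existsUnique_congr fun u => ?_).1 hex)
  · intro h
    rw [if_pos h] at h1
    cases h1
  rw [mem_nbrs_iff, and_assoc]
  refine and_congr_right fun hadj => ?_
  unfold StationTransmits
  rw [hdiv, hmod]
  constructor
  · rintro ⟨⟨p, hp⟩, htr⟩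
    have hpq := entry_le hp
    have hpage : q - p ≤ age G s ω q w := by
      have := le_sup (f := fun u => q - (entry G s ω q u).getD 0)
        (mem_nbrs_iff.2 ⟨hadj, p, hp⟩)
      simpa [hp, age] using this
    obtain ⟨τ, hτ, rfl⟩ := Option.map_eq_some_iff.1 hp
    refine ⟨τ, receptionTime_of_le G s hτ (by omega), hpq, by omega, ?_⟩
    simpa [mem, hp] using htr
  · rintro ⟨τ, hτ, hle, -, htr⟩
    have hτq := firstPhase_le_iff.1 hle
    have hp : entry G s ω q u = some (firstPhase n τ) := by
      unfold entry
      rw [(receptionTime_eq_some_iff G s (receptionTime_self G s hτ).1 hτq).1 hτ]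
      rfl
    exact ⟨⟨_, hp⟩, by simpa [mem, hp] using htr⟩

theorem age_succ_le : age G s ω (q + 1) w ≤ age G s ω q w + 1 := by
  refine Finset.sup_le fun u hu => ?_
  obtain ⟨hadj, p, hp⟩ := mem_nbrs_iff.1 hu
  simp only [hp, Option.getD_some]
  rcases hq : entry G s ω q u with _ | p'
  · have := entry_eq_succ hq hp
    omega
  · obtain rfl : p' = p := by simpa using (entry_succ hq).symm.trans hp
    have := le_sup (f := fun u => q - (entry G s ω q u).getD 0) (mem_nbrs_iff.2 ⟨hadj, p', hq⟩)
    simp only [hq, Option.getD_some] at this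
    change q - p' ≤ age G s ω q w at this
    omega

/-- In each of the remaining phases of the epoch, either a new neighbour of `w` takes part, or
some neighbour of `w` runs `Green-Decay`. -/
def Ready (G : SimpleGraph V) (s : V) (ω : ℕ → V → Draw n) (q : ℕ) (w : V) : Prop :=
  phase n q = 0 ∨ (∃ u ∈ nbrs G s ω q w, (mem G s ω q u).isNew = true) ∨
    ∀ j, phase n q ≤ j → j < ll n → ∃ u ∈ nbrs G s ω q w, (mem G s ω q u).myPhase = some j

theorem ready_congr (h : ∀ i < q, ω i = ω' i) : Ready G s ω q = Ready G s ω' q := by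
  funext w
  unfold Ready
  rw [nbrs_congr h, mem_congr h]

open Classical in
/-- The weight of the state of the neighbourhood of `w` at the beginning of phase `q`. -/
noncomputable def weight (G : SimpleGraph V) (s : V) (ω : ℕ → V → Draw n) (q : ℕ) (w : V) : ℝ :=
  if Ready G s ω q w then 1 else 2 ^ (ll n - phase n q)

theorem weight_congr (h : ∀ i < q, ω i = ω' i) : weight G s ω q = weight G s ω' q := by
  funext w
  unfold weight
  rw [ready_congr h]

theorem one_le_weight : 1 ≤ weight G s ω q w := by
  unfold weight
  split_ifs
  · exact le_rfl
  · exact one_le_pow₀ (by norm_num)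

theorem phase_lt (hn : 32 ≤ n) (q : ℕ) : phase n q < ll n := Nat.mod_lt _ (ll_pos hn)

theorem phase_succ (hn : 32 ≤ n) (q : ℕ) :
    phase n (q + 1) = 0 ∨ phase n (q + 1) = phase n q + 1 := by
  have h3 := three_le_ll hn
  have hlt := phase_lt hn q
  unfold phase at *
  rw [Nat.add_mod, Nat.mod_eq_of_lt (by omega : 1 < ll n)]
  rcases Nat.lt_or_ge (q % ll n + 1) (ll n) with h | h
  · exact Or.inr (Nat.mod_eq_of_lt h)
  · left
    rw [show q % ll n + 1 = ll n by omega, Nat.mod_self]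

theorem weight_succ_le : weight G s ω (q + 1) w ≤ 2 ^ (ll n - 1) := by
  unfold weight
  split_ifs with h
  · exact one_le_pow₀ (by norm_num)
  · have : phase n (q + 1) ≠ 0 := fun h0 => h (Or.inl h0)
    exact pow_le_pow_right₀ (by norm_num) (by omega)

/-- No randomness is involved: either the next state is ready, as at the start of an epoch, or the
number of remaining phases drops by one. Hence `ω'` may be arbitrary. -/
theorem weight_succ_le_half (hn : 32 ≤ n) (h : ¬ Ready G s ω q w) :
    weight G s ω' (q + 1) w ≤ weight G s ω q w / 2 := by
  have hlt := phase_lt hn q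
  have hw : weight G s ω q w = 2 * 2 ^ (ll n - phase n q - 1) := by
    unfold weight
    rw [if_neg h, ← pow_succ']
    congr 1
    omega
  rw [hw, mul_div_cancel_left₀ _ (two_ne_zero)]
  unfold weight
  split_ifs with h'
  · exact one_le_pow₀ (by norm_num)
  · have : phase n (q + 1) ≠ 0 := fun h0 => h' (Or.inl h0)
    exact pow_le_pow_right₀ (by norm_num) (by have := phase_succ hn q; omega)

theorem weight_eq_one (h : Ready G s ω q w) : weight G s ω q w = 1 := if_pos h

theorem ready_succ_of_choosers
    (h : ∀ j : Fin (ll n), ∃ u ∈ choosers n q (mem G s ω q) (nbrs G s ω q w), (ω q u).2.1 = j) :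
    Ready G s ω (q + 1) w := by
  refine Or.inr (Or.inr fun j _ hj => ?_)
  obtain ⟨u, hu, huj⟩ := h ⟨j, hj⟩
  obtain ⟨hu1, hu2⟩ := mem_filter.1 hu
  refine ⟨u, nbrs_subset_succ hu1, ?_⟩
  obtain ⟨-, p, hp⟩ := mem_nbrs_iff.1 hu1
  rw [mem_succ hp]
  have hc : phase n q = 0 ∨ StillNew n q (mem G s ω q u) := by
    by_cases hq : phase n q = 0
    · exact Or.inl hq
    · exact Or.inr ⟨hu2.resolve_left hq, hq⟩
  simp only [Memory.next]
  rw [if_pos hc, huj]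

theorem next_myPhase_of_choosers_eq_empty
    (hc : choosers n q (mem G s ω q) (nbrs G s ω q w) = ∅) (hu : u ∈ nbrs G s ω q w)
    (d : Draw n) :
    ((mem G s ω q u).next q d).myPhase = (mem G s ω q u).myPhase := by
  have hu' : ¬ (phase n q = 0 ∨ (mem G s ω q u).isNew = true) := fun h => by
    have : u ∈ choosers n q (mem G s ω q) (nbrs G s ω q w) := mem_filter.2 ⟨hu, h⟩
    simp [hc] at this
  simp only [Memory.next]
  rw [if_neg fun h => hu' (h.imp_right fun h => h.1)]

theorem ready_succ_of_choosers_eq_empty (hn : 32 ≤ n) (h : Ready G s ω q w)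
    (hc : choosers n q (mem G s ω q) (nbrs G s ω q w) = ∅)
    (hne : (nbrs G s ω q w).Nonempty) :
    (∃ u ∈ nbrs G s ω q w, (mem G s ω q u).myPhase = some (phase n q)) ∧
      Ready G s ω (q + 1) w := by
  have hmem : ∀ u ∈ nbrs G s ω q w, ¬ (phase n q = 0 ∨ (mem G s ω q u).isNew = true) :=
    fun u hu h => by
      have : u ∈ choosers n q (mem G s ω q) (nbrs G s ω q w) := mem_filter.2 ⟨hu, h⟩
      simp [hc] at this
  obtain ⟨u₀, hu₀⟩ := hne
  rcases h with h | ⟨u, hu, h⟩ | h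
  · exact absurd (Or.inl h) (hmem u₀ hu₀)
  · exact absurd (Or.inr h) (hmem u hu)
  · refine ⟨h _ le_rfl (phase_lt hn q), ?_⟩
    rcases phase_succ hn q with h0 | h1
    · exact Or.inl h0
    · refine Or.inr (Or.inr fun j hj hjl => ?_)
      obtain ⟨u, hu, huj⟩ := h j (by omega) hjl
      refine ⟨u, nbrs_subset_succ hu, ?_⟩
      obtain ⟨-, p, hp⟩ := mem_nbrs_iff.1 hu
      rw [mem_succ hp, next_myPhase_of_choosers_eq_empty hc hu, huj]

open Classical in
/-- One phase halves the expected weight of an uninformed station with active neighbours. -/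
theorem expect_weight_le [DecidableEq V] (hn : 32 ≤ n) (hV : Fintype.card V = n) (ω : ℕ → V → Draw n)
    (hne : (nbrs G s ω q w).Nonempty) (hage : age G s ω q w < iterations n) :
    𝔼 e : V → Draw n, (if entry G s (Function.update ω q e) (q + 1) w = none then
      weight G s (Function.update ω q e) (q + 1) w else 0) ≤ weight G s ω q w / 2 := by
  have := nonempty_draw hn
  have hag : ∀ e : V → Draw n, ∀ i < q, ω i = Function.update ω q e i := fun e i hi =>
    (Function.update_of_ne hi.ne _ _).symm
  -- From a ready state the weight is 1 and the target is 1/2. Without choosers readiness persists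
  -- and Green-Decay runs; with choosers `expect_phaseFails_le` applies. From a state that is not
  -- ready the halving is deterministic.
  by_cases hr : Ready G s ω q w
  · have hf : ∀ e, entry G s (Function.update ω q e) (q + 1) w = none →
        PhaseFails q (mem G s ω q) (nbrs G s ω q w) e := fun e he => by
      have := phaseFails_of_entry_eq_none he (by rwa [← age_congr (hag e)])
      rwa [← mem_congr (hag e), ← nbrs_congr (hag e), Function.update_self] at this
    rw [weight_eq_one hr]
    rcases (choosers n q (mem G s ω q) (nbrs G s ω q w)).eq_empty_or_nonempty with hc | hc
    · obtain ⟨hu, -⟩ := ready_succ_of_choosers_eq_empty hn hr hc hne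
      calc _ ≤ 𝔼 e : V → Draw n, (if PhaseFails q (mem G s ω q) (nbrs G s ω q w) e ∧
              ∃ u ∈ nbrs G s ω q w, ((mem G s ω q u).next q (e u)).myPhase = some (phase n q)
              then (1 : ℝ) else 0) := by
            refine expect_le_expect fun e _ => ?_
            by_cases he : entry G s (Function.update ω q e) (q + 1) w = none
            · have hr' : Ready G s (Function.update ω q e) (q + 1) w := by
                refine (ready_succ_of_choosers_eq_empty hn ?_ ?_ ?_).2
                · rwa [← ready_congr (hag e)]
                · rwa [← mem_congr (hag e), ← nbrs_congr (hag e)]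
                · rwa [← nbrs_congr (hag e)]
              have hex : ∃ u ∈ nbrs G s ω q w,
                  ((mem G s ω q u).next q (e u)).myPhase = some (phase n q) :=
                hu.imp fun u hu => ⟨hu.1, by
                  rw [next_myPhase_of_choosers_eq_empty hc hu.1, hu.2]⟩
              rw [if_pos he, weight_eq_one hr', if_pos ⟨hf e he, hex⟩]
            · rw [if_neg he]
              positivity
        _ ≤ 2 / 5 := by
            rw [expect_ite_eq_pr]
            exact pr_phaseFails_and_le hn hV q _ _
        _ ≤ 1 / 2 := by norm_num
    · refine le_trans (expect_le_expect fun e _ => ?_) (expect_phaseFails_le hn hV q _ _ hc)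
      by_cases he : entry G s (Function.update ω q e) (q + 1) w = none
      · rw [if_pos he, if_pos (hf e he)]
        split_ifs with hj
        · refine (weight_eq_one (ready_succ_of_choosers ?_)).le
          rwa [← mem_congr (hag e), ← nbrs_congr (hag e), Function.update_self]
        · exact weight_succ_le
      · rw [if_neg he]
        positivity
  · have hw : 0 ≤ weight G s ω q w := zero_le_one.trans one_le_weight
    calc _ ≤ 𝔼 _e : V → Draw n, weight G s ω q w / 2 := by
          refine expect_le_expect fun e _ => ?_
          split_ifs
          · exact weight_succ_le_half hn hr
          · positivity
      _ = _ := Fintype.expect_const _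

end Network

/-! ### The informed front along a path -/

section Broadcast

variable {V : Type*} {n : ℕ} {G : SimpleGraph V} {s : V}

theorem entry_eq_none_of_succ {ω : ℕ → V → Draw n} {q : ℕ} {v : V}
    (h : entry G s ω (q + 1) v = none) : entry G s ω q v = none := by
  by_contra hne
  obtain ⟨p, hp⟩ := Option.ne_none_iff_exists'.1 hne
  rw [entry_succ hp] at h
  cases h

theorem mem_isNew_of_entry_succ {ω : ℕ → V → Draw n} {q : ℕ} {v : V}
    (h : entry G s ω q v = none) (h' : entry G s ω (q + 1) v ≠ none) :
    (mem G s ω (q + 1) v).isNew = true := by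
  obtain ⟨p, hp⟩ := Option.ne_none_iff_exists'.1 h'
  have := entry_eq_succ h hp
  subst this
  exact mem_isNew_of_entry hp

open Classical in
/-- The index of the last station with the message among `p 0, …, p d`. -/
noncomputable def front (G : SimpleGraph V) (s : V) (p : ℕ → V) (d : ℕ) (ω : ℕ → V → Draw n)
    (q : ℕ) : ℕ := Nat.findGreatest (fun i => entry G s ω q (p i) ≠ none) d

theorem front_congr {p : ℕ → V} {d q : ℕ} {ω ω' : ℕ → V → Draw n} (h : ∀ i < q, ω i = ω' i) :
    front G s p d ω q = front G s p d ω' q := by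
  unfold front
  rw [entry_congr h]

theorem entry_front {p : ℕ → V} (hp : p 0 = s) (d q : ℕ) (ω : ℕ → V → Draw n) :
    entry G s ω q (p (front G s p d ω q)) ≠ none := by
  classical
  unfold front
  have h0 : entry G s ω q (p 0) ≠ none := by
    rw [hp, entry_eq_of_le entry_zero (Nat.zero_le q)]
    exact Option.some_ne_none _
  exact Nat.findGreatest_spec (P := fun i => entry G s ω q (p i) ≠ none) (Nat.zero_le d) h0

theorem entry_eq_none_of_front_lt {p : ℕ → V} {d q i : ℕ} {ω : ℕ → V → Draw n}
    (h : front G s p d ω q < i) (hi : i ≤ d) : entry G s ω q (p i) = none := by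
  classical
  exact not_not.1 (Nat.findGreatest_is_greatest h hi)

theorem front_lt {p : ℕ → V} (hp : p 0 = s) {d q : ℕ} {ω : ℕ → V → Draw n}
    (h : entry G s ω q (p d) = none) : front G s p d ω q < d := by
  classical
  refine lt_of_le_of_ne (Nat.findGreatest_le d) fun heq => ?_
  have := entry_front (G := G) hp d q ω
  rw [heq] at this
  exact this h

end Broadcast

/-! ### Two supermartingales: no stalling, and progress along a path -/

section Broadcast

variable {V : Type*} [Fintype V] {n : ℕ}

/-- The law of the random choices of all stations in one phase. -/
noncomputable def phaseLaw (V : Type*) [Fintype V] (n : ℕ) : Measure (V → Draw n) :=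
  Measure.pi fun _ : V => (ProbabilityTheory.uniformOn Set.univ : Measure (Draw n))

theorem isProbabilityMeasure_phaseLaw (hn : 32 ≤ n) : IsProbabilityMeasure (phaseLaw V n) := by
  have := nonempty_draw hn
  unfold phaseLaw
  infer_instance

theorem phaseLaw_singleton [DecidableEq V] (hn : 32 ≤ n) (e : V → Draw n) :
    phaseLaw V n {e} = (Fintype.card (V → Draw n) : ℝ≥0∞)⁻¹ := by
  have := nonempty_draw hn
  unfold phaseLaw
  rw [Measure.pi_singleton]
  simp only [ProbabilityTheory.uniformOn_univ, Measure.count_singleton, one_div]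
  rw [prod_const, Fintype.card_fun, card_univ, ← ENNReal.inv_pow]
  push_cast
  rfl

variable (G : SimpleGraph V) (s : V)

/-- The station `w` lacks the message although a neighbour has ended its program. -/
def Stalled (ω : ℕ → V → Draw n) (q : ℕ) (w : V) : Prop :=
  entry G s ω q w = none ∧ iterations n ≤ age G s ω q w

variable {G s}

theorem stalled_congr {ω ω' : ℕ → V → Draw n} {q : ℕ} (h : ∀ i < q, ω i = ω' i) :
    Stalled G s ω q = Stalled G s ω' q := by
  funext w
  unfold Stalled
  rw [entry_congr h, age_congr h]

theorem ready_succ_of_entry {ω : ℕ → V → Draw n} {q : ℕ} {u w : V} (hadj : G.Adj w u)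
    (h : entry G s ω q u = none) (h' : entry G s ω (q + 1) u ≠ none) :
    Ready G s ω (q + 1) w :=
  Or.inr (Or.inl ⟨u, mem_nbrs.2 ⟨hadj, h'⟩, mem_isNew_of_entry_succ h h'⟩)

theorem phase_zero (n : ℕ) : phase n 0 = 0 := Nat.zero_mod _

open Classical in
/-- The supermartingale that bounds the probability that `w` gets stalled. -/
noncomputable def stallPotential (G : SimpleGraph V) (s w : V) (q : ℕ) (ω : ℕ → V → Draw n) : ℝ :=
  if entry G s ω q w = none then
    if nbrs G s ω q w = ∅ then 1 else 2 ^ age G s ω q w * weight G s ω q w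
  else 0

theorem stallPotential_nonneg (w : V) (q : ℕ) (ω : ℕ → V → Draw n) :
    0 ≤ stallPotential G s w q ω := by
  unfold stallPotential
  split_ifs
  · exact zero_le_one
  · exact mul_nonneg (by positivity) (zero_le_one.trans one_le_weight)
  · exact le_rfl

/-- The doubling of `2^age` in a phase is offset by the halving of the expected weight. -/
theorem stallPotential_step [DecidableEq V] (hn : 32 ≤ n) (hV : Fintype.card V = n) (w : V) (q : ℕ)
    (ω : ℕ → V → Draw n) (h : ¬ Stalled G s ω q w) :
    𝔼 e, stallPotential G s w (q + 1) (Function.update ω q e) ≤ stallPotential G s w q ω := by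
  classical
  have := nonempty_draw hn
  have hag : ∀ e : V → Draw n, ∀ i < q, Function.update ω q e i = ω i := fun e i hi =>
    Function.update_of_ne hi.ne _ _
  by_cases hw : entry G s ω q w = none
  · have hage : age G s ω q w < iterations n := not_le.1 fun hle => h ⟨hw, hle⟩
    by_cases hne : nbrs G s ω q w = ∅
    -- The first informed neighbours of `w` enter with age 0 and in state new, so the potential then
    -- still equals 1.
    · have hle : ∀ e, stallPotential G s w (q + 1) (Function.update ω q e) ≤ 1 := fun e => by
        set ω' := Function.update ω q e
        have hne' : nbrs G s ω' q w = ∅ := by rw [nbrs_congr (hag e), hne]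
        have hu : ∀ u ∈ nbrs G s ω' (q + 1) w, entry G s ω' q u = none := fun u hu => by
          by_contra hcon
          have : u ∈ nbrs G s ω' q w := mem_nbrs.2 ⟨(mem_nbrs.1 hu).1, hcon⟩
          simp [hne'] at this
        unfold stallPotential
        split_ifs with h1 h2
        · exact le_rfl
        · obtain ⟨u, hu'⟩ := nonempty_iff_ne_empty.2 h2
          have hr := ready_succ_of_entry (mem_nbrs.1 hu').1 (hu u hu') (mem_nbrs.1 hu').2
          have ha : age G s ω' (q + 1) w = 0 := by
            refine Nat.le_zero.1 (Finset.sup_le fun u hu' => ?_)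
            obtain ⟨-, p, hp⟩ := mem_nbrs_iff.1 hu'
            have := entry_eq_succ (hu u hu') hp
            simp [hp, this]
          rw [weight_eq_one hr, ha]
          norm_num
        · exact zero_le_one
      refine (expect_le_expect fun e _ => hle e).trans ?_
      rw [Fintype.expect_const]
      unfold stallPotential
      rw [if_pos hw, if_pos hne]
    · calc _ ≤ 𝔼 e : V → Draw n, 2 ^ (age G s ω q w + 1) *
            (if entry G s (Function.update ω q e) (q + 1) w = none then
              weight G s (Function.update ω q e) (q + 1) w else 0) := by
            refine expect_le_expect fun e _ => ?_
            have hne' : nbrs G s (Function.update ω q e) (q + 1) w ≠ ∅ := by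
              refine nonempty_iff_ne_empty.1 (Finset.Nonempty.mono nbrs_subset_succ ?_)
              rw [nbrs_congr (hag e)]
              exact nonempty_iff_ne_empty.2 hne
            unfold stallPotential
            rw [if_neg hne']
            split_ifs
            · refine mul_le_mul_of_nonneg_right ?_ (zero_le_one.trans one_le_weight)
              refine pow_le_pow_right₀ (by norm_num) (age_succ_le.trans ?_)
              rw [age_congr (hag e)]
            · simp
        _ ≤ 2 ^ (age G s ω q w + 1) * (weight G s ω q w / 2) := by
            rw [← mul_expect]
            gcongr
            exact expect_weight_le hn hV ω (nonempty_iff_ne_empty.2 hne) hage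
        _ = stallPotential G s w q ω := by
            unfold stallPotential
            rw [if_pos hw, if_neg hne, pow_succ]
            ring
  · have hle : ∀ e, stallPotential G s w (q + 1) (Function.update ω q e) = 0 := fun e => by
      unfold stallPotential
      refine if_neg fun h1 => hw ?_
      rw [← entry_congr (hag e)]
      exact entry_eq_none_of_succ h1
    simp only [hle, expect_const_zero]
    exact stallPotential_nonneg _ _ _

theorem randomness_eq (hn : 32 ≤ n) :
    randomness V n hn = Measure.infinitePi fun _ : ℕ => phaseLaw V n := rfl

/-- The potential starts at most 1, and at the first stalled phase it is at least `2 ^ iterations n`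
because the weight is at least 1. -/
theorem measure_stalled_le (hn : 32 ≤ n) (hV : Fintype.card V = n) (w : V) (N : ℕ) :
    randomness V n hn {ω | ∃ q ≤ N, Stalled G s ω q w} ≤
      ENNReal.ofReal (1 / 2 ^ iterations n) := by
  classical
  have := nonempty_draw hn
  have := isProbabilityMeasure_phaseLaw (V := V) hn
  refine le_trans (measure_mono fun ω hω => ?_)
    (measure_hit_le (phaseLaw_singleton hn) (stallPotential G s w)
      (fun q ω => Stalled G s ω q w) ?_ ?_ ?_ ?_ ?_ (by positivity) N)
  · have hex : ∃ q, q ≤ N ∧ Stalled G s ω q w := hω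
    obtain ⟨hN, hst⟩ := Nat.find_spec hex
    refine ⟨Nat.find hex, hN, ?_, fun r hr hr' => Nat.find_min hex hr ⟨hr.le.trans hN, hr'⟩⟩
    have hne : nbrs G s ω (Nat.find hex) w ≠ ∅ := fun h0 => by
      have := hst.2
      simp [age, h0, iterations] at this
    unfold stallPotential
    rw [if_pos hst.1, if_neg hne]
    calc (2 : ℝ) ^ iterations n ≤ 2 ^ age G s ω (Nat.find hex) w :=
          pow_le_pow_right₀ (by norm_num) hst.2
      _ ≤ _ := le_mul_of_one_le_right (by positivity) one_le_weight
  · intro q x y h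
    unfold stallPotential
    rw [entry_congr h, nbrs_congr h, age_congr h, weight_congr h]
  · intro q x y h
    dsimp only
    rw [stalled_congr h]
  · exact fun q x => stallPotential_nonneg w q x
  · exact fun q x hx => stallPotential_step hn hV w q x hx
  · intro x
    unfold stallPotential
    have ha : age G s x 0 w = 0 := Nat.le_zero.1 (Finset.sup_le fun u _ => by simp)
    split_ifs
    · exact le_rfl
    · rw [ha, weight_eq_one (Or.inl (phase_zero n))]
      norm_num
    · exact zero_le_one

open Classical in
/-- The supermartingale that bounds the time until the message reaches the end of a path. -/
noncomputable def pathPotential (G : SimpleGraph V) (s : V) (p : ℕ → V) (d : ℕ) (q : ℕ)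
    (ω : ℕ → V → Draw n) : ℝ :=
  if entry G s ω q (p d) = none then
    4 ^ (d - front G s p d ω q) * (4 / 3) ^ q * weight G s ω q (p (front G s p d ω q + 1))
  else 0

theorem pathPotential_nonneg (p : ℕ → V) (d q : ℕ) (ω : ℕ → V → Draw n) :
    0 ≤ pathPotential G s p d q ω := by
  unfold pathPotential
  split_ifs
  · exact mul_nonneg (by positivity) (zero_le_one.trans one_le_weight)
  · exact le_rfl

/-- If the front stays, the expected weight halves; if it advances, the distance left drops and the
weight becomes 1, a contribution of at most 1/4. Since the weight is at least 1, `weight/2 + 1/4 ≤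
(3/4) weight`, which the growth of `(4/3)^q` compensates. -/
theorem pathPotential_step [DecidableEq V] (hn : 32 ≤ n) (hV : Fintype.card V = n) {p : ℕ → V} {d : ℕ}
    (hp : p 0 = s) (hadj : ∀ i < d, G.Adj (p i) (p (i + 1))) (q : ℕ) (ω : ℕ → V → Draw n)
    (h : ¬ ∃ w, Stalled G s ω q w) :
    𝔼 e, pathPotential G s p d (q + 1) (Function.update ω q e) ≤ pathPotential G s p d q ω := by
  classical
  have := nonempty_draw hn
  have hag : ∀ e : V → Draw n, ∀ i < q, Function.update ω q e i = ω i := fun e i hi =>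
    Function.update_of_ne hi.ne _ _
  by_cases hd : entry G s ω q (p d) = none
  · set f := front G s p d ω q with hf
    set w := p (f + 1)
    have hfd : f < d := front_lt hp hd
    have hw : entry G s ω q w = none := entry_eq_none_of_front_lt (Nat.lt_succ_self _) hfd
    have hage : age G s ω q w < iterations n := not_le.1 fun hle => h ⟨w, hw, hle⟩
    have hne : (nbrs G s ω q w).Nonempty :=
      ⟨p f, mem_nbrs.2 ⟨(hadj f hfd).symm, entry_front hp d q ω⟩⟩
    have hwt : 1 ≤ weight G s ω q w := one_le_weight
    calc _ ≤ 𝔼 e : V → Draw n, 4 ^ (d - f) * (4 / 3) ^ (q + 1) *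
          ((if entry G s (Function.update ω q e) (q + 1) w = none then
            weight G s (Function.update ω q e) (q + 1) w else 0) + 1 / 4) := by
          refine expect_le_expect fun e _ => ?_
          set ω' := Function.update ω q e
          set X : ℝ := if entry G s ω' (q + 1) w = none then weight G s ω' (q + 1) w else 0
            with hX
          have hnn : 0 ≤ X := by
            rw [hX]
            split_ifs
            · exact zero_le_one.trans one_le_weight
            · exact le_rfl
          unfold pathPotential
          by_cases hd' : entry G s ω' (q + 1) (p d) = none
          · rw [if_pos hd']
            set f' := front G s p d ω' (q + 1) with hf'
            have hfd' : f' < d := front_lt hp hd'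
            have hff : f ≤ f' := by
              refine Nat.le_findGreatest hfd.le fun h0 => ?_
              have h1 := entry_front (G := G) hp d q ω
              rw [← entry_congr (hag e)] at h1
              exact h1 (entry_eq_none_of_succ h0)
            rcases hff.eq_or_lt with heq | hlt
            · have hw' : entry G s ω' (q + 1) w = none :=
                entry_eq_none_of_front_lt (by rw [← hf', ← heq]; exact Nat.lt_succ_self _) hfd
              rw [if_pos hw'] at hX
              rw [← heq]
              refine mul_le_mul_of_nonneg_left ?_ (by positivity)
              rw [hX]
              exact le_add_of_nonneg_right (by norm_num)
            -- The new front station was informed during phase `q`, so it is a new neighbour of its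
            -- successor, whose weight is therefore 1.
            · have h1 : entry G s ω' q (p f') = none := by
                rw [entry_congr (hag e)]
                exact entry_eq_none_of_front_lt hlt hfd'.le
              have hr : Ready G s ω' (q + 1) (p (f' + 1)) :=
                ready_succ_of_entry (hadj f' hfd').symm h1 (entry_front hp d (q + 1) ω')
              rw [weight_eq_one hr, mul_one]
              calc (4 : ℝ) ^ (d - f') * (4 / 3) ^ (q + 1)
                  ≤ 4 ^ (d - f - 1) * (4 / 3) ^ (q + 1) := by
                    refine mul_le_mul_of_nonneg_right ?_ (by positivity)
                    exact pow_le_pow_right₀ (by norm_num) (by omega)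
                _ = 4 ^ (d - f) * (4 / 3) ^ (q + 1) * (0 + 1 / 4) := by
                    obtain ⟨m, hm⟩ : ∃ m, d - f = m + 1 := ⟨d - f - 1, by omega⟩
                    rw [hm, Nat.add_sub_cancel, pow_succ 4]
                    ring
                _ ≤ _ := by gcongr
          · rw [if_neg hd']
            positivity
      _ = 4 ^ (d - f) * (4 / 3) ^ (q + 1) *
          ((𝔼 e : V → Draw n, if entry G s (Function.update ω q e) (q + 1) w = none then
            weight G s (Function.update ω q e) (q + 1) w else 0) + 1 / 4) := by
          rw [← mul_expect, expect_add_distrib, Fintype.expect_const]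
      _ ≤ 4 ^ (d - f) * (4 / 3) ^ (q + 1) * (weight G s ω q w / 2 + 1 / 4) := by
          gcongr
          exact expect_weight_le hn hV ω hne hage
      _ ≤ 4 ^ (d - f) * (4 / 3) ^ (q + 1) * (3 / 4 * weight G s ω q w) := by
          gcongr
          linarith
      _ = pathPotential G s p d q ω := by
          unfold pathPotential
          rw [if_pos hd, pow_succ]
          ring
  · have hle : ∀ e, pathPotential G s p d (q + 1) (Function.update ω q e) = 0 := fun e => by
      unfold pathPotential
      refine if_neg fun h1 => hd ?_
      rw [← entry_congr (hag e)]
      exact entry_eq_none_of_succ h1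
    simp only [hle, expect_const_zero]
    exact pathPotential_nonneg _ _ _ _

theorem measure_late_le (hn : 32 ≤ n) (hV : Fintype.card V = n) {p : ℕ → V} {d : ℕ}
    (hp : p 0 = s) (hadj : ∀ i < d, G.Adj (p i) (p (i + 1))) (N : ℕ) :
    randomness V n hn {ω | entry G s ω N (p d) = none ∧ ∀ q < N, ¬ ∃ w, Stalled G s ω q w} ≤
      ENNReal.ofReal (4 ^ d / (4 / 3) ^ N) := by
  classical
  have := nonempty_draw hn
  have := isProbabilityMeasure_phaseLaw (V := V) hn
  refine le_trans (measure_mono fun ω hω => ?_)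
    (measure_hit_le (phaseLaw_singleton hn) (pathPotential G s p d)
      (fun q ω => ∃ w, Stalled G s ω q w) ?_ ?_ ?_ ?_ ?_ (by positivity) N)
  · refine ⟨N, le_rfl, ?_, hω.2⟩
    unfold pathPotential
    rw [if_pos hω.1, mul_assoc]
    refine le_trans ?_ (le_mul_of_one_le_left ?_ (one_le_pow₀ (by norm_num)))
    · exact le_mul_of_one_le_right (by positivity) one_le_weight
    · exact mul_nonneg (by positivity) (zero_le_one.trans one_le_weight)
  · intro q x y h
    unfold pathPotential
    rw [entry_congr h, front_congr h, weight_congr h]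
  · intro q x y h
    dsimp only
    rw [stalled_congr h]
  · exact fun q x => pathPotential_nonneg p d q x
  · exact fun q x hx => pathPotential_step hn hV hp hadj q x hx
  · intro x
    unfold pathPotential
    split_ifs
    · rw [weight_eq_one (Or.inl (phase_zero n)), pow_zero, mul_one, mul_one]
      exact pow_le_pow_right₀ (by norm_num) (Nat.sub_le _ _)
    · positivity

end Broadcast

/-! ### Deterministic energy bound -/

section Energy

variable {V : Type*} {n : ℕ}

theorem memory_isNew_succ (x : ℕ → Draw n) (p i : ℕ) : (memory x p (i + 1)).isNew = false := rfl

/-- After its first iteration a station is no longer new, so `myPhase` can change only when `phase =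
0`, that is, at the start of another epoch. -/
theorem memory_myPhase_eq {x : ℕ → Draw n} {p i j : ℕ} (hij : i ≤ j)
    (h : (p + i) / ll n = (p + j) / ll n) :
    (memory x p (j + 1)).myPhase = (memory x p (i + 1)).myPhase := by
  induction j, hij using Nat.le_induction with
  | base => rfl
  | succ j hij ih =>
    have h1 : (p + i) / ll n ≤ (p + j) / ll n := Nat.div_le_div_right (by omega)
    have h2 : (p + j) / ll n ≤ (p + (j + 1)) / ll n := Nat.div_le_div_right (by omega)
    rw [← ih (by omega)]
    have hph : phase n (p + (j + 1)) ≠ 0 := fun h0 => by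
      have h3 : (p + j) / ll n = (p + (j + 1)) / ll n := by omega
      have h4 := Nat.div_add_mod (p + (j + 1)) (ll n)
      have h5 := Nat.mul_div_le (p + j) (ll n)
      have h6 : (p + (j + 1)) % ll n = 0 := h0
      rw [← h3] at h4
      rcases Nat.eq_zero_or_pos (ll n) with hl | hl
      · rw [hl, Nat.mod_zero] at h6
        omega
      · have h7 := Nat.succ_div_of_dvd (Nat.dvd_of_mod_eq_zero h6)
        rw [← add_assoc] at h3
        omega
    have hnew : ¬ StillNew n (p + (j + 1)) (memory x p (j + 1)) := fun h => by
      have := h.1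
      rw [memory_isNew_succ] at this
      cases this
    change (Memory.next _ _ _).myPhase = _
    simp only [Memory.next]
    rw [if_neg (not_or.2 ⟨hph, hnew⟩)]

theorem GreenDecay.unique {m : ℕ} {c : Fin m → Bool} {r r' : ℕ} (h : GreenDecay c r)
    (h' : GreenDecay c r') (hr : r ≠ 0) (hr' : r' ≠ 0) : r = r' := by
  obtain ⟨j, rfl, hj, hlt⟩ := h.resolve_left hr
  obtain ⟨j', rfl, hj', hlt'⟩ := h'.resolve_left hr'
  rcases lt_trichotomy j j' with h | h | h
  · simp [hlt' j h] at hj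
  · rw [h]
  · simp [hlt j' h] at hj'

/-- The block of a round, where the first round of the third block is separated. -/
noncomputable def roundKind (n r : ℕ) : ℕ :=
  if r < k n then 0 else if r < 2 * k n then 1 else if r = 2 * k n then 2 else 3

/-- The first block is used only in the first iteration, the second only at `phase = 0`. In the
third block the constancy of `myPhase` leaves one phase per epoch, with one transmission in its
first round and at most one after the first successful toss. -/
theorem transmits_injOn (x : ℕ → Draw n) (τ : ℕ) :
    Set.InjOn (fun t => (roundKind n (t % phaseLength n), t / phaseLength n / ll n))
      {t | StationTransmits x τ t} := by
  intro t ht t' ht' heq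
  obtain ⟨hk, he⟩ := Prod.mk.inj heq
  obtain ⟨hp, -, htr⟩ := ht
  obtain ⟨hp', -, htr'⟩ := ht'
  set q := t / phaseLength n with hq
  set q' := t' / phaseLength n with hq'
  set r := t % phaseLength n with hr
  set r' := t' % phaseLength n with hr'
  set p := firstPhase n τ
  have hd := (x q).1.isLt
  have hd' := (x q').1.isLt
  suffices h : q = q' ∧ (q = q' → r = r') by
    rw [← Nat.div_add_mod t (phaseLength n), ← Nat.div_add_mod t' (phaseLength n), ← hq, ← hq',
      ← hr, ← hr', h.2 h.1, h.1]
  have hthird : ∀ {q : ℕ}, p ≤ q → ((memory x p (q - p)).next q (x q)).myPhase =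
      (memory x p (q - p + 1)).myPhase := fun {q} hpq => by
    simp only [memory]
    rw [Nat.add_sub_cancel' hpq]
  have hsame : ((memory x p (q - p)).next q (x q)).myPhase = some (phase n q) →
      ((memory x p (q' - p)).next q' (x q')).myPhase = some (phase n q') → q = q' := by
    intro h h'
    rw [hthird hp] at h
    rw [hthird hp'] at h'
    have hmod : q % ll n = q' % ll n := by
      rcases le_total q q' with hqq | hqq
      · rw [memory_myPhase_eq (by omega : q - p ≤ q' - p)
          (by rwa [Nat.add_sub_cancel' hp, Nat.add_sub_cancel' hp']), h] at h'
        exact Option.some.inj h'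
      · rw [memory_myPhase_eq (by omega : q' - p ≤ q - p)
          (by rw [Nat.add_sub_cancel' hp, Nat.add_sub_cancel' hp', he]), h'] at h
        exact (Option.some.inj h).symm
    rw [← Nat.div_add_mod q (ll n), ← Nat.div_add_mod q' (ll n), he, hmod]
  have hnew : ∀ {q : ℕ}, p ≤ q → StillNew n q (memory x p (q - p)) → q = p :=
    fun {q} hpq h => by
      by_contra hne
      obtain ⟨i, hi⟩ : ∃ i, q - p = i + 1 := ⟨q - p - 1, by omega⟩
      have := h.1
      rw [hi, memory_isNew_succ] at this
      cases this
  unfold roundKind at hk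
  rcases htr with ⟨h1, h2⟩ | ⟨h1, h2, h3⟩ | ⟨h1, h2, h3⟩ <;>
  rcases htr' with ⟨h1', h2'⟩ | ⟨h1', h2', h3'⟩ | ⟨h1', h2', h3'⟩
  · have := hnew hp h1
    have := hnew hp' h1'
    exact ⟨by omega, fun h => by rw [h2, h2', h]⟩
  · split_ifs at hk <;> omega
  · split_ifs at hk <;> omega
  · split_ifs at hk <;> omega
  · refine ⟨?_, fun h => by rw [h3, h3', h]⟩
    have e1 : q % ll n = 0 := h2
    have e2 : q' % ll n = 0 := h2'
    rw [← Nat.div_add_mod q (ll n), ← Nat.div_add_mod q' (ll n), he, e1, e2]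
  · split_ifs at hk <;> omega
  · split_ifs at hk <;> omega
  · split_ifs at hk <;> omega
  · refine ⟨hsame h1 h1', fun h => ?_⟩
    rw [← h] at h3'
    rcases Nat.eq_or_lt_of_le h2 with h4 | h4
    · split_ifs at hk <;> omega
    · have h5 : 2 * k n < r' := by split_ifs at hk <;> omega
      have := h3.unique h3' (by omega) (by omega)
      omega

/-- Four kinds of round, times the number of epochs met by `2L + 2` consecutive phases; the `+ 2`
allows for incomplete epochs at both ends. -/
theorem encard_stationTransmits_le (x : ℕ → Draw n) (τ : ℕ) :
    Set.encard {t | StationTransmits x τ t} ≤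
      ((4 * ((2 * logCeil n + 1) / ll n + 2) : ℕ) : ℕ∞) := by
  set p := firstPhase n τ
  let T : Finset (ℕ × ℕ) := range 4 ×ˢ Icc (p / ll n) ((p + (2 * logCeil n + 1)) / ll n)
  have hmaps : Set.MapsTo (fun t => (roundKind n (t % phaseLength n), t / phaseLength n / ll n))
      {t | StationTransmits x τ t} T := by
    rintro t ⟨h1, h2, -⟩
    refine mem_coe.2 (mem_product.2 ⟨?_, mem_Icc.2 ⟨Nat.div_le_div_right h1,
      Nat.div_le_div_right ?_⟩⟩)
    · rw [mem_range]
      unfold roundKind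
      dsimp only
      split_ifs <;> omega
    · unfold iterations at h2
      omega
  refine (Set.encard_le_encard_of_injOn hmaps (transmits_injOn x τ)).trans ?_
  rw [Set.encard_coe_eq_coe_finsetCard]
  norm_cast
  rw [card_product, card_range, Nat.card_Icc]
  refine Nat.mul_le_mul_left _ ?_
  rcases Nat.eq_zero_or_pos (ll n) with hl | hl
  · simp [hl]
  · have h1 := Nat.add_div hl (a := p) (b := 2 * logCeil n + 1)
    generalize (p + (2 * logCeil n + 1)) / ll n = a at h1 ⊢
    generalize p / ll n = b at h1 ⊢
    generalize (2 * logCeil n + 1) / ll n = c at h1 ⊢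
    split_ifs at h1 <;> omega

theorem energy_le (G : SimpleGraph V) (s : V) (ω : ℕ → V → Draw n) (v : V) :
    energy G s ω v ≤ ((4 * ((2 * logCeil n + 1) / ll n + 2) : ℕ) : ℕ∞) := by
  unfold energy
  rcases Set.eq_empty_or_nonempty {t | Transmits G s ω v t} with h | ⟨t₀, τ₀, h₀, -⟩
  · rw [h, Set.encard_empty]
    exact zero_le
  · refine le_trans (Set.encard_le_encard ?_) (encard_stationTransmits_le (fun q => ω q v) τ₀)
    rintro t ⟨τ, hτ, htr⟩
    have e1 := receptionTime_of_le G s hτ (le_max_left t t₀)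
    have e2 := receptionTime_of_le G s h₀ (le_max_right t t₀)
    obtain rfl : τ = τ₀ := by simpa using e1.symm.trans e2
    exact htr

theorem logCeil_le (hn : 32 ≤ n) : (logCeil n : ℝ) ≤ 6 / 5 * Real.logb 2 n := by
  have h5 := five_le_logb hn
  have : (logCeil n : ℝ) < Real.logb 2 n + 1 := Nat.ceil_lt_add_one (by linarith)
  linarith

theorem energy_le_floor (hn : 32 ≤ n) {C : ℝ} (hC : 24 ≤ C) (G : SimpleGraph V) (s : V)
    (ω : ℕ → V → Draw n) (v : V) :
    energy G s ω v ≤ (⌊C * (Real.logb 2 n / Real.logb 2 (Real.logb 2 n))⌋₊ : ℕ∞) := by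
  refine (energy_le G s ω v).trans ?_
  have h5 := five_le_logb hn
  have h2 := two_lt_logb_logb hn
  set a := Real.logb 2 n
  set b := Real.logb 2 a
  have hba : b ≤ a := by
    rw [Real.logb_le_iff_le_rpow (by norm_num) (by linarith)]
    have := one_add_mul_self_le_rpow_one_add (s := 1) (by norm_num) (p := a) (by linarith)
    norm_num at this
    linarith
  have hab : 1 ≤ a / b := by rw [one_le_div (by linarith)]; exact hba
  have hl : b ≤ ll n := Nat.le_ceil _
  refine Nat.cast_le.2 (Nat.le_floor ?_)
  push_cast
  have hdiv : (((2 * logCeil n + 1) / ll n : ℕ) : ℝ) ≤ 13 / 5 * (a / b) := by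
    calc (((2 * logCeil n + 1) / ll n : ℕ) : ℝ) ≤ ((2 * logCeil n + 1 : ℕ) : ℝ) / ll n :=
          Nat.cast_div_le
      _ ≤ (13 / 5 * a) / b := by
          gcongr
          push_cast
          linarith [logCeil_le hn]
      _ = _ := by ring
  -- Since `a / b ≥ 1`, the bound `4 (13/5 · a/b + 2)` is at most `(92/5) · a/b`, within the
  -- allowance of 24.
  nlinarith

end Energy

/-! ### Union bound and running time -/

section Completion

variable {V : Type*} {n : ℕ} {G : SimpleGraph V} {s : V}

theorem completesBy_of_entry {ω : ℕ → V → Draw n} {N T : ℕ}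
    (hT : phaseLength n * (N + iterations n) ≤ T) (h : ∀ v, entry G s ω N v ≠ none) :
    CompletesBy G s ω T := by
  intro v
  obtain ⟨p, hp⟩ := Option.ne_none_iff_exists'.1 (h v)
  have hpN := entry_le hp
  obtain ⟨τ, hτ, rfl⟩ := Option.map_eq_some_iff.1 hp
  have hN : phaseLength n * N ≤ T := le_trans (Nat.mul_le_mul_left _ (Nat.le_add_right _ _)) hT
  exact ⟨τ, receptionTime_of_le G s hτ hN,
    le_trans (Nat.mul_le_mul_left _ (Nat.add_le_add_right hpN _)) hT⟩

variable [Fintype V]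

/-- An uninformed station at phase `N` means that some station stalled before, or that the message
is late on a shortest path although nobody stalled. Each event has probability at most `1/n²` per
station. -/
theorem measure_exists_entry_eq_none_le (hn : 32 ≤ n) (hV : Fintype.card V = n)
    (hG : G.Connected) :
    randomness V n hn {ω | ∃ v, entry G s ω (6 * (G.diam + logCeil n)) v = none} ≤
      ENNReal.ofReal (2 / n) := by
  set N := 6 * (G.diam + logCeil n)
  have hn0 : (0 : ℝ) < n := by exact_mod_cast (by omega : 0 < n)
  have hL : (n : ℝ) ≤ 2 ^ logCeil n := by exact_mod_cast le_two_pow_logCeil hn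
  have hlate : ∀ v : V, randomness V n hn
      {ω | entry G s ω N v = none ∧ ∀ q < N, ¬ ∃ w, Stalled G s ω q w} ≤
        ENNReal.ofReal (1 / (n * n)) := fun v => by
    obtain ⟨p, hp⟩ := hG.exists_walk_length_eq_dist s v
    have hd : p.length ≤ G.diam := by
      have := hG.nonempty
      rw [hp]
      exact SimpleGraph.dist_le_diam (SimpleGraph.connected_iff_ediam_ne_top.1 hG)
    have h := measure_late_le hn hV (p := p.getVert) (d := p.length) p.getVert_zero
      (fun i hi => p.adj_getVert_succ hi) N
    rw [p.getVert_length] at h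
    refine h.trans (ENNReal.ofReal_le_ofReal ?_)
    -- This is the source of the factor 6 in `N`: six phases pay for one factor 4, and the extra
    -- `6L` phases leave `4^(-L) ≤ 1/n²`.
    have h4 : (4 : ℝ) ≤ (4 / 3) ^ 6 := by norm_num
    rw [div_le_div_iff₀ (by positivity) (by positivity), one_mul, pow_mul]
    calc (4 : ℝ) ^ p.length * (n * n) ≤ 4 ^ G.diam * (2 ^ logCeil n * 2 ^ logCeil n) := by
          gcongr
          norm_num
      _ = 4 ^ (G.diam + logCeil n) := by rw [← mul_pow, pow_add]; norm_num
      _ ≤ ((4 / 3) ^ 6) ^ (G.diam + logCeil n) := by gcongr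
  have hstall : ∀ w : V, randomness V n hn {ω | ∃ q ≤ N, Stalled G s ω q w} ≤
      ENNReal.ofReal (1 / (n * n)) := fun w => by
    refine (measure_stalled_le hn hV w N).trans (ENNReal.ofReal_le_ofReal ?_)
    rw [div_le_div_iff₀ (by positivity) (by positivity), one_mul, one_mul]
    calc (n : ℝ) * n ≤ 2 ^ logCeil n * 2 ^ logCeil n := by gcongr
      _ = 2 ^ (2 * logCeil n) := by rw [two_mul, pow_add]
      _ ≤ 2 ^ iterations n := pow_le_pow_right₀ (by norm_num) (by unfold iterations; omega)
  have hsub : {ω : ℕ → V → Draw n | ∃ v, entry G s ω N v = none} ⊆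
      (⋃ v, {ω | entry G s ω N v = none ∧ ∀ q < N, ¬ ∃ w, Stalled G s ω q w}) ∪
        ⋃ w, {ω | ∃ q ≤ N, Stalled G s ω q w} := by
    rintro ω ⟨v, hv⟩
    by_cases h : ∃ q < N, ∃ w, Stalled G s ω q w
    · obtain ⟨q, hq, w, hw⟩ := h
      exact Or.inr (Set.mem_iUnion.2 ⟨w, q, hq.le, hw⟩)
    · push Not at h
      exact Or.inl (Set.mem_iUnion.2 ⟨v, hv, fun q hq ⟨w, hw⟩ => h q hq w hw⟩)
  have hsum : ∑ _v : V, ENNReal.ofReal (1 / (n * n)) = ENNReal.ofReal (1 / n) := by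
    rw [sum_const, card_univ, hV, nsmul_eq_mul, ← ENNReal.ofReal_natCast,
      ← ENNReal.ofReal_mul hn0.le]
    congr 1
    field_simp
  calc _ ≤ _ := measure_mono hsub
    _ ≤ ∑ v, randomness V n hn
          {ω | entry G s ω N v = none ∧ ∀ q < N, ¬ ∃ w, Stalled G s ω q w} +
        ∑ w, randomness V n hn {ω | ∃ q ≤ N, Stalled G s ω q w} :=
      (measure_union_le _ _).trans
        (add_le_add (measure_iUnion_fintype_le _ _) (measure_iUnion_fintype_le _ _))
    _ ≤ ENNReal.ofReal (1 / n) + ENNReal.ofReal (1 / n) := by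
      rw [← hsum]
      exact add_le_add (sum_le_sum fun v _ => hlate v) (sum_le_sum fun w _ => hstall w)
    _ = ENNReal.ofReal (2 / n) := by
      rw [← ENNReal.ofReal_add (by positivity) (by positivity)]
      congr 1
      ring

theorem le_measure_completesBy (hn : 32 ≤ n) (hV : Fintype.card V = n) (hG : G.Connected)
    {T : ℕ} (hT : phaseLength n * (6 * (G.diam + logCeil n) + iterations n) ≤ T) :
    1 - 2 / (n : ℝ) ≤ (randomness V n hn).real {ω | CompletesBy G s ω T} := by
  have := nonempty_draw hn
  have := isProbabilityMeasure_phaseLaw (V := V) hn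
  have : IsProbabilityMeasure (randomness V n hn) := by
    rw [randomness_eq]; infer_instance
  set N := 6 * (G.diam + logCeil n)
  -- Measurability is needed only for this event, whose complement is contained in the event of
  -- completion.
  have hmeas : MeasurableSet {ω : ℕ → V → Draw n | ∃ v, entry G s ω N v = none} := by
    refine measurableSet_setOfPred.2 (Adapted.measurable (q := N) fun x y h => ?_)
    rw [entry_congr h]
  have hle : (randomness V n hn).real {ω | ∃ v, entry G s ω N v = none} ≤ 2 / n :=
    ENNReal.toReal_le_of_le_ofReal (by positivity) (measure_exists_entry_eq_none_le hn hV hG)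
  calc 1 - 2 / (n : ℝ) ≤ 1 - (randomness V n hn).real {ω | ∃ v, entry G s ω N v = none} := by
        linarith
    _ = (randomness V n hn).real {ω | ∃ v, entry G s ω N v = none}ᶜ :=
        (probReal_compl_eq_one_sub hmeas).symm
    _ ≤ _ := measureReal_mono fun ω hω =>
        completesBy_of_entry hT fun v hv => hω ⟨v, hv⟩

theorem time_bound (hn : 32 ≤ n) (D : ℕ) :
    phaseLength n * (6 * (D + logCeil n) + iterations n) ≤
      ⌊(1000 : ℝ) * ((D : ℝ) + Real.logb 2 n) * Real.logb 2 n⌋₊ := by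
  refine Nat.le_floor ?_
  have h5 := five_le_logb hn
  have hL := logCeil_le hn
  set a := Real.logb 2 n
  unfold phaseLength k iterations
  push_cast
  have h1 : (3 * (24 * logCeil n + 1) : ℝ) ≤ 90 * a := by linarith
  have h2 : (6 * (D + logCeil n) + (2 * logCeil n + 2) : ℝ) ≤ 11 * (D + a) := by
    have : (0 : ℝ) ≤ D := Nat.cast_nonneg D
    linarith
  calc _ ≤ 90 * a * (11 * (D + a)) := by gcongr
    _ ≤ 1000 * (D + a) * a := by
      have : (0 : ℝ) ≤ (D + a) * a := by positivity
      linarith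

end Completion

end GDB

theorem mainTheorem2 :
    ∃ C : ℝ, 0 < C ∧
      ∀ (n : ℕ) (hn : 32 ≤ n) (V : Type*) [Fintype V], Fintype.card V = n →
      ∀ G : SimpleGraph V, G.Connected → ∀ s : V,
        1 - 2 / (n : ℝ) ≤ (GDB.randomness V n hn).real
          {ω | GDB.CompletesBy G s ω
            ⌊C * ((G.diam : ℝ) + Real.logb 2 n) * Real.logb 2 n⌋₊} ∧
        ∀ (ω : ℕ → V → GDB.Draw n) (v : V),
          GDB.energy G s ω v ≤
            (⌊C * (Real.logb 2 n / Real.logb 2 (Real.logb 2 n))⌋₊ : ℕ∞) := by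
  refine ⟨1000, by norm_num, fun n hn V _ hV G hG s => ⟨?_, fun ω v => ?_⟩⟩
  · exact GDB.le_measure_completesBy hn hV hG (GDB.time_bound hn G.diam)
  · exact GDB.energy_le_floor hn (by norm_num) G s ω v
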